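/- Let $X$ be a complex manifold with holomorphic cotangent sheaf $\Omega^1_X$, and let $\omega$ be a Kähler form on $X$, i.e. a smooth closed real $(1,1)$-form with $\omega(u,Ju)>0$ for all tangent vectors $u\neq 0$. Given an open cover $(X_i)$ of $X$ and a Čech cocycle $a=(a_{ij})$ of holomorphic $1$-forms $a_{ij}\in\Gamma(X_i\cap X_j,\Omega^1_X)$, let $\pi: Z_a\to X$ be the holomorphic affine bundle modelled on $\Omega_X^1$ that is glued from the total spaces of $\Omega^1_X|_{X_i}$, where $s_i$ over $X_i$ and $s_j$ over $X_j$ are identified if $s_i=s_j+a_{ij}$ over $X_i\cap X_j$. The cocycle $a$ represents the class $[\omega]\in H^{1,1}(X)\cong H^1(X,\Omega^1_X)$ if there are smooth $(1,0)$-forms $\rho_i$ on $X_i$ with $\bar\partial\rho_i=\omega|_{X_i}$ and $a_{ij}=\rho_i-\rho_j$; in this case $Z_a$ is the canonical extension $Z_{[\omega]}$, and the forms $\rho_i$ patch together to a section $\rho_\omega: X\to Z_{[\omega]}$ of $\pi$. Theorem. A cover $(X_i)$, a cocycle $(a_{ij})$ and forms $(\rho_i)$ as above exist. For every choice of them, the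 section $\rho_\omega: X\to Z_{[\omega]}$ is smooth and is a totally real embedding, i.e. it is a smooth embedding and $$d(\rho_\omega)_x(T_xX)\cap J\, d(\rho_\omega)_x(T_xX)=0\quad\text{for all }x\in X,$$ where $J$ is the complex structure of $Z_{[\omega]}$. Moreover, if $\omega$ is real analytic, then $\rho_\omega$ is real analytic. -/

import Mathlib

open scoped Manifold ContDiff Topology Bundle
open Set Bundle

universe u v

noncomputable section

namespace CanonicalExtension

/-! ### Differential forms on a complex manifold

Throughout, a complex manifold is a space `X` charted on a finite-dimensional complex vector space
`E` with `IsManifold 𝓘(ℂ, E) ω X`, i.e. with holomorphic (complex analytic) transition maps. Its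
tangent space `TangentSpace 𝓘(ℂ, E) x` is a complex vector space, and multiplication by
`Complex.I` is the complex structure `J`. -/

section Forms

variable {E : Type*} [NormedAddCommGroup E] [NormedSpace ℂ E]
  {X : Type*} [TopologicalSpace X] [ChartedSpace E X]

variable (E X) in
/-- (Pointwise, not yet differentiable) real `2`-forms on `X`. -/
abbrev RealTwoForm : Type _ :=
  ∀ x : X, (TangentSpace 𝓘(ℂ, E) x) [⋀^Fin 2]→L[ℝ] ℝ

variable (E X) in
/-- (Pointwise, not yet differentiable) `(1,0)`-forms on `X`: at each point a complex linear
functional on the holomorphic tangent space. -/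
abbrev OneZeroForm : Type _ :=
  ∀ x : X, (TangentSpace 𝓘(ℂ, E) x) →L[ℂ] ℂ

/-- The derivative of the inverse of a chart, as a complex linear map from the model space. -/
def chartSymmDeriv (e : OpenPartialHomeomorph X E) (z : E) :
    E →L[ℂ] TangentSpace 𝓘(ℂ, E) (e.symm z) :=
  mfderiv 𝓘(ℂ, E) 𝓘(ℂ, E) e.symm z

/-- The expression of a real `2`-form in the chart `e`, i.e. its pullback under `e.symm`. -/
def RealTwoForm.inChart (κ : RealTwoForm E X) (e : OpenPartialHomeomorph X E) (z : E) :
    E [⋀^Fin 2]→L[ℝ] ℝ :=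
  (κ (e.symm z)).compContinuousLinearMap ((chartSymmDeriv e z).restrictScalars ℝ)

/-- The expression of a `(1,0)`-form in the chart `e`, i.e. its pullback under `e.symm`; in
coordinates `∑ f_p dz_p` becomes the function `(f_p)`. -/
def OneZeroForm.inChart (α : OneZeroForm E X) (e : OpenPartialHomeomorph X E) (z : E) :
    E →L[ℂ] ℂ :=
  (α (e.symm z)).comp (chartSymmDeriv e z)

/-- A real `2`-form is of (real) class `C^n` if its expressions in all charts are. -/
def RealTwoForm.IsOfClass (n : ℕ∞ω) (κ : RealTwoForm E X) : Prop :=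
  ∀ e ∈ atlas E X, ContDiffOn ℝ n (κ.inChart e) e.target

/-- A Kähler form: a smooth closed real `2`-form of type `(1,1)` (i.e. `J`-invariant) which is
positive, i.e. `κ(u, Ju) > 0` for `u ≠ 0`. -/
structure IsKahlerForm (κ : RealTwoForm E X) : Prop where
  smooth : κ.IsOfClass ∞
  closed : ∀ e ∈ atlas E X, ∀ z ∈ e.target, extDeriv (κ.inChart e) z = 0
  typeOneOne : ∀ x (u v : TangentSpace 𝓘(ℂ, E) x),
    κ x ![Complex.I • u, Complex.I • v] = κ x ![u, v]
  pos : ∀ x (u : TangentSpace 𝓘(ℂ, E) x), u ≠ 0 → 0 < κ x ![u, Complex.I • u]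

/-- A `(1,0)`-form is of (real) class `C^n` on the open set `U`. -/
def OneZeroForm.IsOfClassOn (n : ℕ∞ω) (α : OneZeroForm E X) (U : Set X) : Prop :=
  ∀ e ∈ atlas E X, ContDiffOn ℝ n (α.inChart e) (e.target ∩ e.symm ⁻¹' U)

/-- A `(1,0)`-form is holomorphic on the open set `U`, i.e. a section of `Ω¹` over `U`. -/
def OneZeroForm.IsHolomorphicOn (α : OneZeroForm E X) (U : Set X) : Prop :=
  ∀ e ∈ atlas E X, ContDiffOn ℂ ω (α.inChart e) (e.target ∩ e.symm ⁻¹' U)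

/-- The antilinear part `u ↦ (Df(u) + i Df(iu)) / 2` of the real derivative of `f`; in coordinates
it is `∑ (∂f/∂z̄_q) dz̄_q(u)`. -/
def antilinearDeriv (f : E → (E →L[ℂ] ℂ)) (z u : E) : E →L[ℂ] ℂ :=
  (2⁻¹ : ℂ) • (fderiv ℝ f z u + Complex.I • fderiv ℝ f z (Complex.I • u))

/-- The value on `(u, v)` of the `(1,1)`-form `∂̄(∑ f_p dz_p) = ∑ (∂f_p/∂z̄_q) dz̄_q ∧ dz_p`. -/
def dbar (f : E → (E →L[ℂ] ℂ)) (z u v : E) : ℂ :=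
  antilinearDeriv f z u v - antilinearDeriv f z v u

/-- `∂̄α = κ` on the open set `U`, checked in all charts. -/
def OneZeroForm.DbarEqOn (α : OneZeroForm E X) (κ : RealTwoForm E X) (U : Set X) : Prop :=
  ∀ e ∈ atlas E X, ∀ z ∈ e.target ∩ e.symm ⁻¹' U, ∀ u v : E,
    dbar (α.inChart e) z u v = (κ.inChart e z ![u, v] : ℂ)

variable (E X) in
/-- A Čech `1`-cocycle with values in the sheaf `Ω¹` of holomorphic `1`-forms, with respect to the
open cover `cover`. Only the values of `a i j` on `cover i ∩ cover j` matter. -/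
structure Cocycle (ι : Type v) where
  cover : ι → Set X
  isOpen_cover : ∀ i, IsOpen (cover i)
  exists_mem_cover : ∀ x, ∃ i, x ∈ cover i
  a : ι → ι → OneZeroForm E X
  holomorphic : ∀ i j, (a i j).IsHolomorphicOn (cover i ∩ cover j)
  cocycle : ∀ i j k, ∀ x ∈ cover i ∩ cover j ∩ cover k, a i j x + a j k x = a i k x

/-- `(ρ i)` is a family of smooth local `∂̄`-primitives of `κ`, `∂̄ρ_i = κ` on the `i`-th open set,
with `a_ij = ρ_i - ρ_j`. The existence of such a family says precisely that the cocycle represents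
the Dolbeault class of `κ` under `H^{1,1}(X) ≅ H¹(X, Ω¹)`. -/
structure Cocycle.IsPrimitive {ι : Type v} (c : Cocycle E X ι) (κ : RealTwoForm E X)
    (ρ : ι → OneZeroForm E X) : Prop where
  smooth : ∀ i, (ρ i).IsOfClassOn ∞ (c.cover i)
  dbar_eq : ∀ i, (ρ i).DbarEqOn κ (c.cover i)
  sub_eq : ∀ i j, ∀ x ∈ c.cover i ∩ c.cover j, c.a i j x = ρ i x - ρ j x

theorem Cocycle.a_self {ι : Type v} (c : Cocycle E X ι) (i : ι) {x : X} (hx : x ∈ c.cover i) :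
    c.a i i x = 0 := by
  simpa using c.cocycle i i i x ⟨⟨hx, hx⟩, hx⟩

end Forms

/-! ### The affine bundle of a cocycle -/

section AffineBundle

variable {E : Type*} [NormedAddCommGroup E] [NormedSpace ℂ E]
  {X : Type*} [TopologicalSpace X] [ChartedSpace E X] [IsManifold 𝓘(ℂ, E) ω X]
  {ι : Type v}

theorem mdifferentiableAt_symm {e : OpenPartialHomeomorph X E} (he : e ∈ atlas E X) {z : E}
    (hz : z ∈ e.target) : MDifferentiableAt 𝓘(ℂ, E) 𝓘(ℂ, E) e.symm z := by
  have : IsManifold 𝓘(ℂ, E) 1 X := IsManifold.of_le (n := ω) le_top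
  exact mdifferentiableAt_atlas_symm he hz

theorem contDiffOn_transition {e e' : OpenPartialHomeomorph X E} (he : e ∈ atlas E X)
    (he' : e' ∈ atlas E X) : ContDiffOn ℂ ω (e ∘ e'.symm) (e'.symm ≫ₕ e).source := by
  have h := (contDiffGroupoid ω 𝓘(ℂ, E)).compatible he' he
  rw [contDiffGroupoid, mem_groupoid_of_pregroupoid] at h
  simpa [contDiffPregroupoid] using h.1

/-- The transformation rule for local expressions of `(1,0)`-forms under a change of charts. -/
theorem OneZeroForm.inChart_comp (α : OneZeroForm E X) {e e' : OpenPartialHomeomorph X E}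
    (he : e ∈ atlas E X) (he' : e' ∈ atlas E X) {x : X} (hx : x ∈ e.source) (hx' : x ∈ e'.source) :
    (α.inChart e (e x)).comp (fderiv ℂ (e ∘ e'.symm) (e' x)) = α.inChart e' (e' x) := by
  have hz : e' x ∈ (e'.symm ≫ₕ e).source := by simp [hx, hx']
  have hT : DifferentiableAt ℂ (e ∘ e'.symm) (e' x) :=
    ((contDiffOn_transition he he').contDiffAt
      ((e'.symm ≫ₕ e).open_source.mem_nhds hz)).differentiableAt (by simp)
  have hval : (e ∘ e'.symm) (e' x) = e x := by simp [hx']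
  have hev : e'.symm =ᶠ[𝓝 (e' x)] e.symm ∘ (e ∘ e'.symm) := by
    filter_upwards [(e'.symm ≫ₕ e).open_source.mem_nhds hz] with w hw
    simp only [OpenPartialHomeomorph.trans_source, OpenPartialHomeomorph.symm_source, mem_inter_iff,
      mem_preimage] at hw
    simp [hw.2]
  have hd : MDifferentiableAt 𝓘(ℂ, E) 𝓘(ℂ, E) e.symm ((e ∘ e'.symm) (e' x)) := by
    rw [hval]
    exact mdifferentiableAt_symm he (e.map_source hx)
  have key := (hd.hasMFDerivAt.comp (e' x) hT.hasFDerivAt.hasMFDerivAt).congr_of_eventuallyEq hev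
  have h1 := key.mfderiv
  have aux : ∀ (y z w : X) (_ : y = w) (_ : z = w) (A B : E →L[ℂ] E), A = B →
      ((α y : E →L[ℂ] ℂ).comp A) = ((α z : E →L[ℂ] ℂ).comp B) := by
    rintro _ _ _ rfl rfl _ _ rfl
    rfl
  have h2 : ((mfderiv 𝓘(ℂ, E) 𝓘(ℂ, E) e.symm (e x) : E →L[ℂ] E).comp
      (fderiv ℂ (e ∘ e'.symm) (e' x))) = mfderiv 𝓘(ℂ, E) 𝓘(ℂ, E) e'.symm (e' x) := by
    rw [← hval]
    exact h1.symm
  exact aux _ _ x (by simp [hx]) (by simp [hx']) _ _ h2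

namespace Cocycle

variable (c : Cocycle E X ι)

/-- The transition maps of the affine bundle. A point of the fibre over `x` is a family of
covectors `s_i` at `x`, for all `i` with `x ∈ cover i`, with `s_i = s_j + a_ij`. The index `(i, e)`
stands for reading off `s_i` in the chart `e`. The change from `(i, e)` to `(j, e')` is therefore
the change of coordinates of covectors from `e` to `e'` followed by adding `a_ji`. -/
def coordChange (p q : ι × atlas E X) (x : X) (v : E →L[ℂ] ℂ) : E →L[ℂ] ℂ :=
  v.comp (fderiv ℂ (p.2.1 ∘ q.2.1.symm) (q.2.1 x)) + (c.a q.1 p.1).inChart q.2.1 (q.2.1 x)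

/-- The set over which the trivialization with index `(i, e)` is defined. -/
def baseSet (p : ι × atlas E X) : Set X := c.cover p.1 ∩ p.2.1.source


theorem contMDiffOn_coordChange (p q : ι × atlas E X) :
    ContMDiffOn (𝓘(ℂ, E).prod 𝓘(ℂ, E →L[ℂ] ℂ)) 𝓘(ℂ, E →L[ℂ] ℂ) ω
      (fun y : X × (E →L[ℂ] ℂ) ↦ c.coordChange p q y.1 y.2)
      ((c.baseSet p ∩ c.baseSet q) ×ˢ univ) := by
  obtain ⟨i, e, he⟩ := p
  obtain ⟨j, e', he'⟩ := q
  have h1 : ContMDiffOn (𝓘(ℂ, E).prod 𝓘(ℂ, E →L[ℂ] ℂ)) 𝓘(ℂ, E) ω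
      (fun y : X × (E →L[ℂ] ℂ) ↦ e' y.1)
      ((c.baseSet (i, ⟨e, he⟩) ∩ c.baseSet (j, ⟨e', he'⟩)) ×ˢ univ) :=
    (contMDiffOn_of_mem_maximalAtlas
      (IsManifold.subset_maximalAtlas (I := 𝓘(ℂ, E)) (n := ω) he')).comp contMDiffOn_fst
      (fun y hy ↦ hy.1.2.2)
  have h2 : ContDiffOn ℂ ω (fderiv ℂ (e ∘ e'.symm)) (e'.symm ≫ₕ e).source :=
    (contDiffOn_transition he he').fderiv_of_isOpen (e'.symm ≫ₕ e).open_source le_rfl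
  have h3 := h2.contMDiffOn.comp h1 (fun y hy ↦ by
    have h := hy.1.2.2
    have h' := hy.1.1.2
    simp only at h h'
    simp [h, h'])
  have h4 := (c.holomorphic j i e' he').contMDiffOn.comp h1 (fun y hy ↦ by
    have h := hy.1.2.2
    have h0 := hy.1.2.1
    have h' := hy.1.1.1
    simp only at h h' h0
    simp [h, h', h0])
  have h5 : ContMDiffOn (𝓘(ℂ, E).prod 𝓘(ℂ, E →L[ℂ] ℂ)) 𝓘(ℂ, E →L[ℂ] ℂ) ω
      (fun y : X × (E →L[ℂ] ℂ) ↦ y.2)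
      ((c.baseSet (i, ⟨e, he⟩) ∩ c.baseSet (j, ⟨e', he'⟩)) ×ˢ univ) := contMDiffOn_snd
  exact (h5.clm_comp h3).add h4

/-- The gluing data of the affine bundle `Z_a` of the cocycle `a`, a locally trivial bundle with
fibre the space of covectors and affine transition maps. -/
def core : FiberBundleCore (ι × atlas E X) X (E →L[ℂ] ℂ) where
  baseSet := c.baseSet
  isOpen_baseSet p := (c.isOpen_cover p.1).inter p.2.1.open_source
  indexAt x := ((c.exists_mem_cover x).choose, achart E x)
  mem_baseSet_at x := ⟨(c.exists_mem_cover x).choose_spec, mem_chart_source E x⟩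
  coordChange := c.coordChange
  coordChange_self := by
    rintro ⟨i, e, he⟩ x ⟨hi, hx⟩ v
    simp only at hi hx
    have h : fderiv ℂ (e ∘ e.symm) (e x) = .id ℂ E := by
      have : (e ∘ e.symm) =ᶠ[𝓝 (e x)] id := by
        filter_upwards [e.open_target.mem_nhds (e.map_source hx)] with w hw
        simp [hw]
      rw [this.fderiv_eq, fderiv_id]
    have h0 : (c.a i i).inChart e (e x) = 0 := by
      have : c.a i i (e.symm (e x)) = 0 := c.a_self i (by rwa [e.left_inv hx])
      simp [OneZeroForm.inChart, this]
    simp [coordChange, h, h0]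
  continuousOn_coordChange p q := (c.contMDiffOn_coordChange p q).continuousOn
  coordChange_comp := by
    rintro ⟨i, e, he⟩ ⟨j, e', he'⟩ ⟨k, e'', he''⟩ x ⟨⟨⟨hi, hx⟩, ⟨hj, hx'⟩⟩, ⟨hk, hx''⟩⟩ v
    simp only at hi hx hj hx' hk hx''
    have hD : (fderiv ℂ (e ∘ e'.symm) (e' x)).comp (fderiv ℂ (e' ∘ e''.symm) (e'' x)) =
        fderiv ℂ (e ∘ e''.symm) (e'' x) := by
      have hz : e'' x ∈ (e''.symm ≫ₕ e').source := by simp [hx', hx'']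
      have hz' : e' x ∈ (e'.symm ≫ₕ e).source := by simp [hx, hx']
      have hev : e ∘ e''.symm =ᶠ[𝓝 (e'' x)] (e ∘ e'.symm) ∘ (e' ∘ e''.symm) := by
        filter_upwards [(e''.symm ≫ₕ e').open_source.mem_nhds hz] with w hw
        simp only [OpenPartialHomeomorph.trans_source, OpenPartialHomeomorph.symm_source,
          mem_inter_iff, mem_preimage] at hw
        simp [hw.2]
      have hval : (e' ∘ e''.symm) (e'' x) = e' x := by simp [hx'']
      have d1 : DifferentiableAt ℂ (e' ∘ e''.symm) (e'' x) :=
        ((contDiffOn_transition he' he'').contDiffAt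
          ((e''.symm ≫ₕ e').open_source.mem_nhds hz)).differentiableAt (by simp)
      have d2 : DifferentiableAt ℂ (e ∘ e'.symm) ((e' ∘ e''.symm) (e'' x)) := by
        rw [hval]
        exact ((contDiffOn_transition he he').contDiffAt
          ((e'.symm ≫ₕ e).open_source.mem_nhds hz')).differentiableAt (by simp)
      rw [hev.fderiv_eq, fderiv_comp _ d2 d1, hval]
    have hA := (c.a j i).inChart_comp he' he'' hx' hx''
    have hC : (c.a j i).inChart e'' (e'' x) + (c.a k j).inChart e'' (e'' x) =
        (c.a k i).inChart e'' (e'' x) := by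
      have := c.cocycle k j i (e''.symm (e'' x)) (by simp [hx'', hi, hj, hk])
      simp only [OneZeroForm.inChart, ← this, ContinuousLinearMap.add_comp]
      exact add_comm _ _
    simp only [coordChange]
    rw [← hC, ← hA, ← hD, ContinuousLinearMap.add_comp, ContinuousLinearMap.comp_assoc, add_assoc]

/-- The affine bundle `Z_a → X` of the cocycle `a`, modelled on the holomorphic cotangent bundle.
Its projection to `X` is `Bundle.TotalSpace.proj`. -/
abbrev Z : Type _ := c.core.TotalSpace

/-- The affine bundle `Z_a` is a complex manifold. -/
instance isManifold_Z : IsManifold (𝓘(ℂ, E).prod 𝓘(ℂ, E →L[ℂ] ℂ)) ω c.Z := by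
  apply isManifold_of_contDiffOn
  rintro _ _ ⟨_, ⟨_, ⟨p, rfl⟩, rfl⟩, _, ⟨e, he, _, rfl, rfl⟩, rfl⟩
    ⟨_, ⟨_, ⟨q, rfl⟩, rfl⟩, _, ⟨e', he', _, rfl, rfl⟩, rfl⟩
  have hm := IsManifold.subset_maximalAtlas (I := 𝓘(ℂ, E)) (n := ω) he
  have hm' := IsManifold.subset_maximalAtlas (I := 𝓘(ℂ, E)) (n := ω) he'
  set S : Set (E × (E →L[ℂ] ℂ)) :=
    {y | y.1 ∈ e.target ∧ e.symm y.1 ∈ c.baseSet p ∩ c.baseSet q ∧ e.symm y.1 ∈ e'.source} with hS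
  have h1 : ContMDiffOn (𝓘(ℂ, E).prod 𝓘(ℂ, E →L[ℂ] ℂ)) 𝓘(ℂ, E) ω
      (fun y : E × (E →L[ℂ] ℂ) ↦ e.symm y.1) S :=
    (contMDiffOn_symm_of_mem_maximalAtlas hm).comp contMDiffOn_fst (fun y hy ↦ hy.1)
  have h2 : ContMDiffOn (𝓘(ℂ, E).prod 𝓘(ℂ, E →L[ℂ] ℂ)) 𝓘(ℂ, E) ω
      (fun y : E × (E →L[ℂ] ℂ) ↦ e' (e.symm y.1)) S :=
    (contMDiffOn_of_mem_maximalAtlas hm').comp h1 (fun y hy ↦ hy.2.2)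
  have h3 : ContMDiffOn (𝓘(ℂ, E).prod 𝓘(ℂ, E →L[ℂ] ℂ)) 𝓘(ℂ, E →L[ℂ] ℂ) ω
      (fun y : E × (E →L[ℂ] ℂ) ↦ c.coordChange p q (e.symm y.1) y.2) S :=
    (c.contMDiffOn_coordChange p q).comp (h1.prodMk contMDiffOn_snd)
      (fun y hy ↦ ⟨hy.2.1, mem_univ _⟩)
  have h4 : ContDiffOn ℂ ω (fun y : E × (E →L[ℂ] ℂ) ↦
      (e' (e.symm y.1), c.coordChange p q (e.symm y.1) y.2)) S := by
    rw [← modelWithCornersSelf_prod, chartedSpaceSelf_prod] at h2 h3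
    exact h2.contDiffOn.prodMk h3.contDiffOn
  refine (h4.congr ?_).mono ?_
  · rintro ⟨z, w⟩ hy
    refine Prod.ext rfl ?_
    exact c.core.coordChange_comp p (c.core.indexAt (e.symm z)) q (e.symm z)
      ⟨⟨hy.2.1.1, c.core.mem_baseSet_at _⟩, hy.2.1.2⟩ w
  · rintro ⟨z, w⟩ ⟨⟨⟨h, h'⟩, ⟨h'', h'''⟩⟩, -⟩
    exact ⟨h.1, ⟨(c.core.mem_localTriv_target p _).1 h', (c.core.mem_localTriv_source q _).1 h''⟩,
      h'''.1⟩

/-- A family `(ρ_i)` of `(1,0)`-forms with `ρ_i - ρ_j = a_ij` defines the section of `Z_a` whose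
component with index `(i, e)` at `x` is the expression of `ρ_i` in the chart `e`. -/
def sectionOf (ρ : ι → OneZeroForm E X) (x : X) : c.Z :=
  ⟨x, (ρ (c.core.indexAt x).1).inChart (c.core.indexAt x).2.1 ((c.core.indexAt x).2.1 x)⟩

/-- The section defined by a family `(ρ_i)` with `ρ_i - ρ_j = a_ij` reads `ρ_i` in all the
trivializations belonging to the `i`-th open set. -/
theorem localTriv_sectionOf {ρ : ι → OneZeroForm E X}
    (hρ : ∀ i j, ∀ x ∈ c.cover i ∩ c.cover j, c.a i j x = ρ i x - ρ j x)
    (p : ι × atlas E X) {x : X} (hx : x ∈ c.baseSet p) :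
    c.core.localTriv p (c.sectionOf ρ x) = (x, (ρ p.1).inChart p.2.1 (p.2.1 x)) := by
  have h0 := c.core.mem_baseSet_at x
  rw [FiberBundleCore.localTriv_apply]
  refine Prod.ext rfl ?_
  change c.coordChange (c.core.indexAt x) p x _ = _
  simp only [sectionOf, coordChange]
  rw [OneZeroForm.inChart_comp _ (c.core.indexAt x).2.2 p.2.2 h0.2 hx.2]
  have hs : p.2.1.symm (p.2.1 x) = x := p.2.1.left_inv hx.2
  have h := hρ p.1 (c.core.indexAt x).1 (p.2.1.symm (p.2.1 x)) (by
    rw [hs]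
    exact ⟨hx.1, h0.1⟩)
  simp only [OneZeroForm.inChart, h, ContinuousLinearMap.sub_comp]
  exact add_sub_cancel _ _

end Cocycle
end AffineBundle

/-! ### Totally real embeddings -/

section TotallyReal

variable {V : Type*} [NormedAddCommGroup V] [NormedSpace ℝ V] [NormedSpace ℂ V]
  [IsScalarTower ℝ ℂ V] {H : Type*} [TopologicalSpace H]
  {V' : Type*} [NormedAddCommGroup V'] [NormedSpace ℝ V'] {H' : Type*} [TopologicalSpace H']
  {M : Type*} [TopologicalSpace M] [ChartedSpace H' M]
  {Z : Type*} [TopologicalSpace Z] [ChartedSpace H Z]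

/-- The complex structure `J` on the tangent space of a complex manifold, regarded as a real
manifold with model `J'`: tangent vectors at `p` are identified with the model space through the
holomorphic chart at `p`, and `J` is multiplication by the imaginary unit. -/
def complexStructure (J' : ModelWithCorners ℝ V H) (p : Z) :
    TangentSpace J' p →ₗ[ℝ] TangentSpace J' p :=
  ((LinearMap.lsmul ℂ V Complex.I).restrictScalars ℝ : V →ₗ[ℝ] V)

/-- A totally real embedding of a smooth real manifold `M` (with model `I'`) into a complex
manifold `Z` (with underlying real model `J'`): a smooth embedding `f` such that
`df(T_x M) ∩ J df(T_x M) = 0` for all `x`. -/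
def IsTotallyRealEmbedding (I' : ModelWithCorners ℝ V' H') (J' : ModelWithCorners ℝ V H)
    (f : M → Z) : Prop :=
  Manifold.IsSmoothEmbedding I' J' ∞ f ∧
    ∀ x : M, LinearMap.range (mfderiv I' J' f x).toLinearMap ⊓
      (LinearMap.range (mfderiv I' J' f x).toLinearMap).map (complexStructure J' (f x)) = ⊥

end TotallyReal

end CanonicalExtension

end

noncomputable section

namespace CanonicalExtension

set_option linter.unusedSectionVars false

/-! ### Holomorphic functions of several variables are analytic -/

section Osgood

open Metric

variable {W : Type*} [NormedAddCommGroup W] [NormedSpace ℂ W]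
  {F : Type*} [NormedAddCommGroup F] [NormedSpace ℂ F]

/-! In the trivialization of index `i` the section is `z ↦ (z, ρ_i z)`, so it is as regular as
`ρ_i`. It is an embedding because the bundle projection is a left inverse, and an immersion because
the shear `(z, s) ↦ (z, s - ρ_i z)` flattens its image. The tangent space of the image is the graph
of the real derivative `D` of `ρ_i`. A vector lying in both this graph and `i` times it yields `v`
with `D (i v) = i D v`, so the antilinear part of `D` kills `v`. For a `J`-invariant form the
equation `∂̄ρ_i = κ` determines that antilinear part: it is `(u, v) ↦ (κ(u, v) - i κ(u, i v)) / 2`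
(`dbar_eq_iff`). At `(v, v)` this equals `-i κ(v, J v) / 2`, so positivity forces `v = 0`.

Local primitives exist because `dκ = 0` makes this antilinear part a `∂̄`-closed `(0,1)`-form with
values in covectors (`dbarDeriv_antilinearPart_comm`). The `∂̄`-Poincaré lemma
`exists_dbarDeriv_eq_of_closed` then applies; it removes one coordinate direction at a time with the
Cauchy transform. Two primitives differ by a form with vanishing `∂̄`, which is holomorphic by
Osgood's lemma, so the differences are a cocycle.

If `κ` is real analytic, so is the right-hand side of the `∂̄`-equation. It extends holomorphically
to independent variables `(z, ζ)` with `ζ` in place of `conj z`, is integrated in `ζ`, and is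
restricted to `ζ = conj z`. This gives an analytic solution, which differs from the given one by a
holomorphic function (`analyticAt_of_dbarDeriv_eq`). -/

theorem norm_line_sub_le {z v : W} {l : ℂ} {r : ℝ} (hl : ‖l‖ ≤ r) : ‖z + l • v - z‖ ≤ r * ‖v‖ := by
  rw [add_sub_cancel_left, norm_smul]
  gcongr

theorem differentiableAt_comp_line {f : W → F} {z v : W} {l : ℂ}
    (hf : DifferentiableAt ℂ f (z + l • v)) :
    HasDerivAt (fun l : ℂ ↦ f (z + l • v)) (fderiv ℂ f (z + l • v) v) l := by
  have h1 : HasDerivAt (fun l : ℂ ↦ z + l • v) v l := by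
    simpa using ((hasDerivAt_id l).smul_const v).const_add z
  exact hf.hasFDerivAt.comp_hasDerivAt l h1

/-- Cauchy's estimate for the derivative of a holomorphic function of several variables. -/
theorem norm_fderiv_le_of_closedBall {f : W → F} {z : W} {r M : ℝ} (hr : 0 < r)
    (hf : ∀ w ∈ closedBall z r, DifferentiableAt ℂ f w) (hM : ∀ w ∈ closedBall z r, ‖f w‖ ≤ M) :
    ‖fderiv ℂ f z‖ ≤ M / r := by
  have hM0 : 0 ≤ M := (norm_nonneg _).trans (hM z (mem_closedBall_self hr.le))
  refine ContinuousLinearMap.opNorm_le_bound _ (by positivity) fun v ↦ ?_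
  rcases eq_or_ne v 0 with rfl | hv
  · simp
  have hv' : 0 < ‖v‖ := norm_pos_iff.2 hv
  have hmem : ∀ l ∈ closedBall (0 : ℂ) (r / ‖v‖), z + l • v ∈ closedBall z r := fun l hl ↦ by
    rw [mem_closedBall, dist_eq_norm]
    refine (norm_line_sub_le (mem_closedBall_zero_iff.1 hl)).trans_eq ?_
    field_simp
  have hd : DifferentiableOn ℂ (fun l : ℂ ↦ f (z + l • v)) (closedBall 0 (r / ‖v‖)) := fun l hl ↦
    (differentiableAt_comp_line (hf _ (hmem l hl))).differentiableAt.differentiableWithinAt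
  have h := Complex.norm_deriv_le_of_forall_mem_sphere_norm_le (C := M) (div_pos hr hv')
    (hd.diffContOnCl_ball subset_rfl) fun l hl ↦ hM _ (hmem l (sphere_subset_closedBall hl))
  have h0 := (differentiableAt_comp_line (v := v) (l := 0)
    (by simpa using hf z (mem_closedBall_self hr.le))).deriv
  rw [h0] at h
  simp only [zero_smul, add_zero] at h
  refine h.trans_eq ?_
  field_simp

theorem exists_closedBall_bound {f : W → F} {U : Set W} (hU : IsOpen U)
    (hf : DifferentiableOn ℂ f U) {z : W} (hz : z ∈ U) :
    ∃ r > 0, ∃ M, closedBall z r ⊆ U ∧ ∀ w ∈ closedBall z r, ‖f w‖ ≤ M := by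
  have h1 := (hf.differentiableAt (hU.mem_nhds hz)).continuousAt.norm.eventually_le_const
    (lt_add_one ‖f z‖)
  obtain ⟨r, hr, h⟩ := nhds_basis_closedBall.eventually_iff.1 ((hU.eventually_mem hz).and h1)
  exact ⟨r, hr, _, fun w hw ↦ (h hw).1, fun w hw ↦ (h hw).2⟩

/-- Cauchy's estimate on balls of radius `r / 2` centred in the half-size ball, all of which stay
inside the ball where `f` is bounded. -/
theorem exists_closedBall_fderiv_bound {f : W → F} {U : Set W} (hU : IsOpen U)
    (hf : DifferentiableOn ℂ f U) {z : W} (hz : z ∈ U) :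
    ∃ r > 0, ∃ M, closedBall z r ⊆ U ∧ ∀ w ∈ closedBall z r, ‖fderiv ℂ f w‖ ≤ M := by
  obtain ⟨r, hr, M, hrU, hM⟩ := exists_closedBall_bound hU hf hz
  refine ⟨r / 2, half_pos hr, M / (r / 2), (closedBall_subset_closedBall (by linarith)).trans hrU,
    fun w hw ↦ ?_⟩
  have hsub : closedBall w (r / 2) ⊆ closedBall z r := by
    refine closedBall_subset_closedBall' ?_
    have := mem_closedBall.1 hw
    linarith
  exact norm_fderiv_le_of_closedBall (half_pos hr)
    (fun y hy ↦ hf.differentiableAt (hU.mem_nhds (hrU (hsub hy)))) fun y hy ↦ hM y (hsub hy)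

/-- The difference `fderiv ℂ f y - fderiv ℂ f z` is the derivative at `z` of `w ↦ f (w + (y - z)) -
f w`. By the mean value inequality this function is `O(‖y - z‖)` on a fixed ball, and Cauchy's
estimate passes the bound to its derivative. -/
theorem continuousOn_fderiv_of_differentiableOn {f : W → F} {U : Set W} (hU : IsOpen U)
    (hf : DifferentiableOn ℂ f U) : ContinuousOn (fderiv ℂ f) U := by
  intro z hz
  refine ContinuousAt.continuousWithinAt ?_
  obtain ⟨r, hr, L, hrU, hL⟩ := exists_closedBall_fderiv_bound hU hf hz
  have hdiff : ∀ w ∈ closedBall z r, DifferentiableAt ℂ f w := fun w hw ↦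
    hf.differentiableAt (hU.mem_nhds (hrU hw))
  have key : ∀ y ∈ closedBall z (r / 2), ‖fderiv ℂ f y - fderiv ℂ f z‖ ≤ L * ‖y - z‖ / (r / 2) := by
    intro y hy
    have hy' := mem_closedBall_iff_norm.1 hy
    have hmem : ∀ w ∈ closedBall z (r / 2), w + (y - z) ∈ closedBall z r ∧ w ∈ closedBall z r := by
      intro w hw
      have hw' := mem_closedBall_iff_norm.1 hw
      constructor
      · rw [mem_closedBall_iff_norm, add_sub_right_comm]
        linarith [norm_add_le (w - z) (y - z)]
      · exact closedBall_subset_closedBall (by linarith) hw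
    have h1 : ∀ w ∈ closedBall z (r / 2), HasFDerivAt (fun w ↦ f (w + (y - z)) - f w)
        (fderiv ℂ f (w + (y - z)) - fderiv ℂ f w) w := fun w hw ↦
      ((hasFDerivAt_comp_add_right _).2 (hdiff _ (hmem w hw).1).hasFDerivAt).sub
        (hdiff _ (hmem w hw).2).hasFDerivAt
    have h2 := norm_fderiv_le_of_closedBall (half_pos hr) (fun w hw ↦ (h1 w hw).differentiableAt)
      (M := L * ‖y - z‖) (fun w hw ↦ by
        have := (convex_closedBall z r).norm_image_sub_le_of_norm_fderiv_le (𝕜 := ℂ) hdiff hL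
          (hmem w hw).2 (hmem w hw).1
        simpa using this)
    rw [(h1 z (mem_closedBall_self (half_pos hr).le)).fderiv] at h2
    simpa using h2
  rw [ContinuousAt, tendsto_iff_norm_sub_tendsto_zero]
  refine squeeze_zero' (.of_forall fun _ ↦ norm_nonneg _)
    (Filter.eventually_of_mem (closedBall_mem_nhds z (half_pos hr)) key) ?_
  have : Continuous fun y : W ↦ L * ‖y - z‖ / (r / 2) := by fun_prop
  simpa using this.tendsto z

theorem differentiableOn_clm_of_apply [FiniteDimensional ℂ W] {V : Type*} [NormedAddCommGroup V]
    [NormedSpace ℂ V] {U : Set V} {g : V → W →L[ℂ] F}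
    (h : ∀ v, DifferentiableOn ℂ (fun z ↦ g z v) U) : DifferentiableOn ℂ g U := by
  let b := Module.finBasis ℂ W
  have : g = fun z ↦ ∑ i, ContinuousLinearMap.smulRightL ℂ W F
      (LinearMap.toContinuousLinearMap (b.coord i)) (g z (b i)) := by
    funext z
    ext v
    conv_lhs => rw [← b.sum_repr v]
    simp only [map_sum, map_smul, _root_.sum_apply]
    rfl
  rw [this]
  exact DifferentiableOn.fun_sum fun i _ ↦
    (ContinuousLinearMap.differentiable _).comp_differentiableOn (h (b i))

/-- The derivative of a holomorphic function of several variables is holomorphic. -/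
theorem differentiableOn_fderiv_of_differentiableOn [FiniteDimensional ℂ W] [CompleteSpace F]
    {f : W → F} {U : Set W} (hU : IsOpen U) (hf : DifferentiableOn ℂ f U) :
    DifferentiableOn ℂ (fderiv ℂ f) U := by
  refine differentiableOn_clm_of_apply fun v z hz ↦
    DifferentiableAt.differentiableWithinAt ?_
  obtain ⟨r, hr, L, hrU, hL⟩ := exists_closedBall_fderiv_bound hU hf hz
  -- The circle of radius `ρ` in direction `v` around any point of the half-size ball must stay in
  -- the ball of radius `r`; the `+ 1` allows `v = 0`.
  obtain ⟨ρ, hρ, hρv⟩ : ∃ ρ > 0, ρ * ‖v‖ ≤ r / 2 := by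
    refine ⟨r / 2 / (‖v‖ + 1), by positivity, ?_⟩
    rw [div_mul_eq_mul_div, div_le_iff₀ (by positivity)]
    nlinarith [norm_nonneg v]
  have hmem : ∀ y ∈ ball z (r / 2), ∀ l ∈ closedBall (0 : ℂ) ρ, y + l • v ∈ closedBall z r := by
    intro y hy l hl
    have h1 := norm_line_sub_le (z := y) (v := v) (mem_closedBall_zero_iff.1 hl)
    rw [mem_ball_iff_norm] at hy
    rw [mem_closedBall_iff_norm]
    calc ‖y + l • v - z‖ = ‖(y + l • v - y) + (y - z)‖ := by congr 1; abel
      _ ≤ _ := norm_add_le _ _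
      _ ≤ r := by linarith
  have hdiff : ∀ w ∈ closedBall z r, DifferentiableAt ℂ f w := fun w hw ↦
    hf.differentiableAt (hU.mem_nhds (hrU hw))
  have hcirc : ∀ θ, circleMap 0 ρ θ ∈ closedBall (0 : ℂ) ρ := fun θ ↦
    circleMap_mem_closedBall 0 hρ.le θ
  -- One-variable Cauchy formula for the derivative along the line through `y`. On its right side
  -- `y` enters only through `f`, so one differentiation under the integral gives differentiability
  -- of the derivative.
  have hrep : ∀ y ∈ ball z (r / 2), fderiv ℂ f y v = (2 * Real.pi * Complex.I : ℂ)⁻¹ •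
      ∫ θ in (0 : ℝ)..2 * Real.pi, deriv (circleMap 0 ρ) θ •
        ((circleMap 0 ρ θ - 0) ^ 2)⁻¹ • f (y + circleMap 0 ρ θ • v) := by
    intro y hy
    have hO : IsOpen {l : ℂ | y + l • v ∈ U} := hU.preimage (by fun_prop)
    have hd : DifferentiableOn ℂ (fun l : ℂ ↦ f (y + l • v)) {l : ℂ | y + l • v ∈ U} := fun l hl ↦
      (differentiableAt_comp_line (hf.differentiableAt (hU.mem_nhds hl))).differentiableAt.differentiableWithinAt
    have h1 := Complex.cderiv_eq_deriv hO hd hρ fun l hl ↦ hrU (hmem y hy l hl)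
    have h0 := (differentiableAt_comp_line (v := v) (l := 0) (z := y) (f := f) (by
      simpa using hdiff _ (hmem y hy 0 (mem_closedBall_self hρ.le)))).deriv
    rw [h0] at h1
    simp only [zero_smul, add_zero] at h1
    rw [← h1]
    rfl
  have hev : (fun y ↦ fderiv ℂ f y v) =ᶠ[𝓝 z] fun y ↦ (2 * Real.pi * Complex.I : ℂ)⁻¹ •
      ∫ θ in (0 : ℝ)..2 * Real.pi, deriv (circleMap 0 ρ) θ •
        ((circleMap 0 ρ θ - 0) ^ 2)⁻¹ • f (y + circleMap 0 ρ θ • v) :=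
    Filter.eventually_of_mem (ball_mem_nhds z (half_pos hr)) hrep
  refine DifferentiableAt.congr_of_eventuallyEq ?_ hev
  refine DifferentiableAt.const_smul ?_ _
  have hz0 : z ∈ ball z (r / 2) := mem_ball_self (half_pos hr)
  have hne : ∀ θ, (circleMap 0 ρ θ - 0) ^ 2 ≠ 0 := fun θ ↦ by
    simpa using hρ.ne'
  have hk : Continuous fun θ ↦ ((circleMap 0 ρ θ - 0) ^ 2)⁻¹ :=
    (((continuous_circleMap 0 ρ).sub continuous_const).pow 2).inv₀ hne
  have hk' : Continuous (deriv (circleMap 0 ρ)) := by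
    have : deriv (circleMap 0 ρ) = fun θ ↦ circleMap 0 ρ θ * Complex.I := by
      funext θ; exact deriv_circleMap ..
    rw [this]
    exact (continuous_circleMap 0 ρ).mul continuous_const
  have hfc : ∀ y ∈ ball z (r / 2), Continuous fun θ ↦ f (y + circleMap 0 ρ θ • v) := fun y hy ↦
    hf.continuousOn.comp_continuous (by fun_prop) fun θ ↦ hrU (hmem y hy _ (hcirc θ))
  have hfc' : Continuous fun θ ↦ fderiv ℂ f (z + circleMap 0 ρ θ • v) :=
    (continuousOn_fderiv_of_differentiableOn hU hf).comp_continuous (by fun_prop)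
      fun θ ↦ hrU (hmem z hz0 _ (hcirc θ))
  refine (intervalIntegral.hasFDerivAt_integral_of_dominated_of_fderiv_le
    (F' := fun y θ ↦ deriv (circleMap 0 ρ) θ •
      ((circleMap 0 ρ θ - 0) ^ 2)⁻¹ • fderiv ℂ f (y + circleMap 0 ρ θ • v))
    (bound := fun θ ↦ ‖deriv (circleMap 0 ρ) θ‖ * (‖((circleMap 0 ρ θ - 0) ^ 2)⁻¹‖ * L))
    (ball_mem_nhds z (half_pos hr)) ?_ ?_ ?_ ?_ ?_ ?_).differentiableAt
  · refine Filter.eventually_of_mem (ball_mem_nhds z (half_pos hr)) fun y hy ↦ ?_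
    exact (hk'.smul (hk.smul (hfc y hy))).aestronglyMeasurable
  · exact (hk'.smul (hk.smul (hfc z hz0))).intervalIntegrable _ _
  · exact (hk'.smul (hk.smul hfc')).aestronglyMeasurable
  · refine .of_forall fun θ _ y hy ↦ ?_
    rw [norm_smul, norm_smul]
    gcongr
    exact hL _ (hmem y hy _ (hcirc θ))
  · exact (hk'.norm.mul (hk.norm.mul continuous_const)).intervalIntegrable _ _
  · refine .of_forall fun θ _ y hy ↦ ?_
    exact (((hasFDerivAt_comp_add_right _).2
      (hdiff _ (hmem y hy _ (hcirc θ))).hasFDerivAt).const_smul _).const_smul _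

theorem differentiableOn_linearIsometryEquiv_comp {𝕜 A B C : Type*} [NontriviallyNormedField 𝕜]
    [NormedAddCommGroup A] [NormedSpace 𝕜 A] [NormedAddCommGroup B] [NormedSpace 𝕜 B]
    [NormedAddCommGroup C] [NormedSpace 𝕜 C] (L : B ≃ₗᵢ[𝕜] C) {g : A → B} {U : Set A}
    (h : DifferentiableOn 𝕜 g U) : DifferentiableOn 𝕜 (L ∘ g) U :=
  L.comp_differentiableOn_iff.2 h

theorem differentiableOn_iteratedFDeriv_succ {𝕜 A B : Type*} [NontriviallyNormedField 𝕜]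
    [NormedAddCommGroup A] [NormedSpace 𝕜 A] [NormedAddCommGroup B] [NormedSpace 𝕜 B]
    {f : A → B} {U : Set A} {n : ℕ} (h : DifferentiableOn 𝕜 (fderiv 𝕜 (iteratedFDeriv 𝕜 n f)) U) :
    DifferentiableOn 𝕜 (iteratedFDeriv 𝕜 (n + 1) f) U := by
  rw [iteratedFDeriv_succ_eq_comp_left]
  exact differentiableOn_linearIsometryEquiv_comp (𝕜 := 𝕜) (A := A) (B := A →L[𝕜] (A [×n]→L[𝕜] B))
    (C := A [×(n + 1)]→L[𝕜] B) _ h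

theorem differentiableOn_iteratedFDeriv [FiniteDimensional ℂ W] [CompleteSpace F]
    {f : W → F} {U : Set W} (hU : IsOpen U) (hf : DifferentiableOn ℂ f U) (n : ℕ) :
    DifferentiableOn ℂ (iteratedFDeriv ℂ n f) U := by
  induction n with
  | zero =>
    rw [iteratedFDeriv_zero_eq_comp]
    exact (LinearIsometryEquiv.differentiable _).comp_differentiableOn hf
  | succ n ih =>
    exact differentiableOn_iteratedFDeriv_succ (differentiableOn_fderiv_of_differentiableOn hU ih)

/-- Cauchy's estimates for all derivatives, on shrinking balls. -/
theorem norm_iteratedFDeriv_le_of_closedBall [FiniteDimensional ℂ W] [CompleteSpace F]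
    {f : W → F} {U : Set W} (hU : IsOpen U) (hf : DifferentiableOn ℂ f U) {z : W} {R ρ M : ℝ}
    (hρ : 0 < ρ) (hR : closedBall z R ⊆ U) (hM : ∀ w ∈ closedBall z R, ‖f w‖ ≤ M) (n : ℕ) :
    ∀ w ∈ closedBall z (R - n * ρ), ‖iteratedFDeriv ℂ n f w‖ ≤ M / ρ ^ n := by
  induction n with
  | zero => simpa using hM
  | succ n ih =>
    intro w hw
    have hsub : closedBall w ρ ⊆ closedBall z (R - n * ρ) := by
      refine closedBall_subset_closedBall' ?_
      have := mem_closedBall.1 hw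
      push_cast at this
      linarith
    have hsub' : closedBall z (R - n * ρ) ⊆ closedBall z R :=
      closedBall_subset_closedBall (by nlinarith [mul_nonneg (Nat.cast_nonneg (α := ℝ) n) hρ.le])
    rw [← norm_fderiv_iteratedFDeriv, pow_succ, ← div_div]
    exact norm_fderiv_le_of_closedBall hρ
      (fun y hy ↦ (differentiableOn_iteratedFDeriv hU hf n).differentiableAt
        (hU.mem_nhds (hR (hsub' (hsub hy))))) fun y hy ↦ ih y (hsub hy)

/-- This identifies the Taylor coefficients of `f` with those of its restrictions to complex lines,
so that convergence to `f` can be taken from one variable. -/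
theorem iteratedDeriv_comp_line [FiniteDimensional ℂ W] [CompleteSpace F]
    {f : W → F} {U : Set W} (hU : IsOpen U) (hf : DifferentiableOn ℂ f U) {z v : W} (n : ℕ) :
    ∀ l : ℂ, z + l • v ∈ U → iteratedDeriv n (fun l : ℂ ↦ f (z + l • v)) l =
      iteratedFDeriv ℂ n f (z + l • v) fun _ ↦ v := by
  induction n with
  | zero => simp
  | succ n ih =>
    intro l hl
    have hO : IsOpen {l : ℂ | z + l • v ∈ U} := hU.preimage (by fun_prop)
    have hev : iteratedDeriv n (fun l : ℂ ↦ f (z + l • v)) =ᶠ[𝓝 l]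
        fun l ↦ iteratedFDeriv ℂ n f (z + l • v) fun _ ↦ v :=
      Filter.eventually_of_mem (hO.mem_nhds hl) ih
    rw [iteratedDeriv_succ, hev.deriv_eq]
    have h1 := differentiableAt_comp_line (v := v) (l := l) (z := z)
      ((differentiableOn_iteratedFDeriv hU hf n).differentiableAt (hU.mem_nhds hl))
    have h2 := ((ContinuousMultilinearMap.apply ℂ (fun _ : Fin n ↦ W) F
      (fun _ ↦ v)).hasFDerivAt.comp_hasDerivAt l h1).deriv
    exact h2

/-- **Osgood's lemma**: a complex differentiable function on an open subset of a finite-dimensional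
complex vector space is analytic. -/
theorem analyticOnNhd_of_differentiableOn [FiniteDimensional ℂ W] [CompleteSpace F]
    {f : W → F} {U : Set W} (hU : IsOpen U) (hf : DifferentiableOn ℂ f U) :
    AnalyticOnNhd ℂ f U := by
  intro z hz
  obtain ⟨R, hR, M, hRU, hM⟩ := exists_closedBall_bound hU hf hz
  have hM0 : 0 ≤ M := (norm_nonneg _).trans (hM z (mem_closedBall_self hR.le))
  -- Taking `n` Cauchy estimates with step `R / (n + 1)` bounds the `n`-th derivative by `M ((n + 1)
  -- / R) ^ n`. Since `(n + 1) ^ n / n! ≤ e ^ (n + 1)`, the series has radius at least `R / e`.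
  obtain ⟨r, hr⟩ : ∃ r : NNReal, (r : ℝ) = R / Real.exp 1 := ⟨⟨R / Real.exp 1, by positivity⟩, rfl⟩
  have hrR : (r : ℝ) ≤ R := hr ▸ div_le_self hR.le (Real.one_le_exp zero_le_one)
  set p : FormalMultilinearSeries ℂ W F := fun n ↦ ((n.factorial : ℂ)⁻¹) • iteratedFDeriv ℂ n f z
    with hp
  refine ⟨p, r, ?_, ?_, ?_⟩
  · refine p.le_radius_of_bound (M * Real.exp 1) fun n ↦ ?_
    have h1 := norm_iteratedFDeriv_le_of_closedBall hU hf (ρ := R / (n + 1)) (by positivity) hRU hM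
      n z (mem_closedBall_self (by
        have : n * (R / (n + 1)) ≤ R := by
          rw [mul_div_assoc', div_le_iff₀ (by positivity)]
          nlinarith
        linarith))
    have h2 : ((n : ℝ) + 1) ^ n / n.factorial ≤ Real.exp (n + 1) :=
      Real.pow_div_factorial_le_exp _ (by positivity) n
    have h3 : Real.exp ((n : ℝ) + 1) = Real.exp 1 * Real.exp 1 ^ n := by
      rw [add_comm, Real.exp_add, ← Real.exp_nat_mul, mul_one]
    calc ‖p n‖ * (r : ℝ) ^ n ≤ ((n.factorial : ℝ)⁻¹ * (M / (R / (n + 1)) ^ n)) * (R / Real.exp 1) ^ n := by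
          rw [hr, hp, norm_smul, norm_inv, Complex.norm_natCast]
          gcongr
      _ = M * (((n : ℝ) + 1) ^ n / n.factorial) / Real.exp 1 ^ n := by
          rw [div_pow, div_pow]
          field_simp
      _ ≤ M * (Real.exp 1 * Real.exp 1 ^ n) / Real.exp 1 ^ n := by
          rw [← h3]
          gcongr
      _ = M * Real.exp 1 := by field_simp
  · have : (0 : ℝ) < r := by rw [hr]; positivity
    exact_mod_cast this
  · intro y hy
    have hy' : ‖y‖ < R := by
      rw [Metric.eball_coe, mem_ball_zero_iff] at hy
      exact hy.trans_le hrR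
    -- The one-variable Taylor series along `y` is evaluated at `1`, so its disc needs a radius
    -- larger than `1`.
    obtain ⟨s, hs1, hs⟩ : ∃ s : ℝ, 1 < s ∧ s * ‖y‖ ≤ R := by
      rcases eq_or_ne y 0 with rfl | h0
      · exact ⟨2, one_lt_two, by simpa using hR.le⟩
      · have := norm_pos_iff.2 h0
        exact ⟨R / ‖y‖, (one_lt_div this).2 hy', by field_simp; rfl⟩
    have hd : DifferentiableOn ℂ (fun l : ℂ ↦ f (z + l • y)) (ball 0 s) := fun l hl ↦
      (differentiableAt_comp_line (hf.differentiableAt (hU.mem_nhds (hRU (by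
        rw [mem_closedBall_iff_norm]
        exact (norm_line_sub_le (mem_ball_zero_iff.1 hl).le).trans
          hs))))).differentiableAt.differentiableWithinAt
    have h := Complex.hasSum_taylorSeries_on_ball hd (z := 1) (by simpa using hs1)
    simp only [sub_zero, one_pow, one_smul] at h
    convert h using 2 with n
    rw [iteratedDeriv_comp_line hU hf n 0 (by simpa using hz)]
    simp [hp]

end Osgood

/-! ### The Cauchy transform -/

section CauchyTransform

open MeasureTheory Filter

variable {F : Type*} [NormedAddCommGroup F] [NormedSpace ℝ F] [NormedSpace ℂ F]
  [IsScalarTower ℝ ℂ F]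

/-- The unit complex number with angle `θ`. -/
abbrev unitCircleMap (θ : ℝ) : ℂ := Real.cos θ + Real.sin θ * Complex.I

theorem hasDerivAt_unitCircleMap (θ : ℝ) :
    HasDerivAt unitCircleMap (unitCircleMap θ * Complex.I) θ := by
  have h := ((Real.hasDerivAt_cos θ).ofReal_comp).add
    (((Real.hasDerivAt_sin θ).ofReal_comp).mul_const Complex.I)
  refine h.congr_deriv ?_
  simp only [unitCircleMap]
  push_cast
  linear_combination -(Complex.sin θ) * Complex.I_sq

theorem norm_unitCircleMap (θ : ℝ) : ‖unitCircleMap θ‖ = 1 := by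
  simp [unitCircleMap, Complex.norm_cos_add_sin_mul_I]

theorem continuous_unitCircleMap : Continuous unitCircleMap := by
  unfold unitCircleMap
  fun_prop

theorem integrableOn_of_continuous_of_eq_zero {F : Type*} [NormedAddCommGroup F] {A : ℝ × ℝ → F} (hA : Continuous A) {R : ℝ}
    (h0 : ∀ r θ, R < r → A (r, θ) = 0) :
    IntegrableOn A (Ioi 0 ×ˢ Ioo (-Real.pi) Real.pi) (volume.prod volume) := by
  have h1 : IntegrableOn A (Icc 0 R ×ˢ Icc (-Real.pi) Real.pi) (volume.prod volume) :=
    hA.continuousOn.integrableOn_compact (isCompact_Icc.prod isCompact_Icc)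
  refine (h1.of_forall_sdiff_eq_zero (s := Icc 0 R ×ˢ Icc (-Real.pi) Real.pi)
    (t := Ioi 0 ×ˢ Ioo (-Real.pi) Real.pi) (measurableSet_Ioi.prod measurableSet_Ioo) ?_)
  rintro ⟨r, θ⟩ ⟨⟨hr, hθ⟩, hn⟩
  refine h0 r θ (not_le.1 fun hle ↦ hn ⟨⟨le_of_lt hr, hle⟩, Ioo_subset_Icc_self hθ⟩)

theorem coe_real_smul (r : ℝ) (x : F) : (r : ℂ) • x = r • x := algebraMap_smul ℂ r x

/-- The **Cauchy–Pompeiu formula** for compactly supported functions. -/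
theorem integral_inv_smul_fderiv [CompleteSpace F] {φ : ℂ → F} (hφ : ContDiff ℝ 1 φ)
    (hc : HasCompactSupport φ) :
    ∫ w : ℂ, w⁻¹ • (fderiv ℝ φ w 1 + Complex.I • fderiv ℝ φ w Complex.I) =
      -(2 * Real.pi) • φ 0 := by
  have hdiff : Differentiable ℝ φ := hφ.differentiable one_ne_zero
  have hcont : Continuous (fderiv ℝ φ) := hφ.continuous_fderiv one_ne_zero
  obtain ⟨R, hR0, hR⟩ : ∃ R : ℝ, 0 < R ∧ ∀ w : ℂ, R < ‖w‖ → φ w = 0 ∧ fderiv ℝ φ w = 0 := by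
    obtain ⟨R, hR⟩ := hc.isCompact.isBounded.subset_closedBall 0
    refine ⟨max R 1, by positivity, fun w hw ↦ ?_⟩
    have : w ∉ tsupport φ := fun h ↦ by
      have := mem_closedBall_zero_iff.1 (hR h)
      exact absurd hw (not_lt.2 (this.trans (le_max_left _ _)))
    exact ⟨image_eq_zero_of_notMem_tsupport this,
      image_eq_zero_of_notMem_tsupport fun h ↦ this (tsupport_fderiv_subset ℝ h)⟩
  set P : ℝ × ℝ → ℂ := fun p ↦ p.1 * unitCircleMap p.2 with hP
  have hPc : Continuous P := by
    have := continuous_unitCircleMap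
    fun_prop
  have hPn : ∀ r θ, R < r → R < ‖P (r, θ)‖ := fun r θ hr ↦ by
    simp only [hP, norm_mul, norm_unitCircleMap, mul_one, Complex.norm_real, Real.norm_eq_abs]
    exact hr.trans_le (le_abs_self r)
  set A : ℝ × ℝ → F := fun p ↦ fderiv ℝ φ (P p) (unitCircleMap p.2) with hA
  set B : ℝ × ℝ → F := fun p ↦ fderiv ℝ φ (P p) (unitCircleMap p.2 * Complex.I) with hB
  have hAc : Continuous A := (hcont.comp hPc).clm_apply (continuous_unitCircleMap.comp continuous_snd)
  have hBc : Continuous B := (hcont.comp hPc).clm_apply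
    ((continuous_unitCircleMap.comp continuous_snd).mul continuous_const)
  have hA0 : ∀ r θ, R < r → A (r, θ) = 0 := fun r θ hr ↦ by
    simp [hA, (hR _ (hPn r θ hr)).2]
  have hB0 : ∀ r θ, R < r → B (r, θ) = 0 := fun r θ hr ↦ by
    simp [hB, (hR _ (hPn r θ hr)).2]
  have hAi := integrableOn_of_continuous_of_eq_zero hAc hA0
  have hBi := integrableOn_of_continuous_of_eq_zero hBc hB0
  -- The polar Jacobian `r` cancels the singularity of `w⁻¹`. What is left is the radial derivative
  -- `A` plus `i` times `B`, the angular derivative divided by `r`.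
  have key : ∀ p ∈ polarCoord.target, p.1 • ((Complex.polarCoord.symm p)⁻¹ •
      (fderiv ℝ φ (Complex.polarCoord.symm p) 1 +
        Complex.I • fderiv ℝ φ (Complex.polarCoord.symm p) Complex.I)) =
      A p + Complex.I • B p := by
    rintro ⟨r, θ⟩ ⟨hr, -⟩
    have hr' : (r : ℂ) ≠ 0 := by
      simp only [mem_Ioi] at hr
      exact_mod_cast hr.ne'
    have hu : unitCircleMap θ ≠ 0 := by
      rw [← norm_ne_zero_iff, norm_unitCircleMap]
      exact one_ne_zero
    have hsq : (Real.cos θ : ℂ) ^ 2 + (Real.sin θ : ℂ) ^ 2 = 1 := by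
      exact_mod_cast Real.cos_sq_add_sin_sq θ
    have hinv : (unitCircleMap θ)⁻¹ = Real.cos θ - Real.sin θ * Complex.I := by
      refine inv_eq_of_mul_eq_one_left ?_
      simp only [unitCircleMap]
      linear_combination hsq - (Real.sin θ : ℂ) ^ 2 * Complex.I_sq
    rw [Complex.polarCoord_symm_apply]
    change r • ((P (r, θ))⁻¹ • (fderiv ℝ φ (P (r, θ)) 1 +
      Complex.I • fderiv ℝ φ (P (r, θ)) Complex.I)) = _
    have e1 : A (r, θ) = (Real.cos θ : ℂ) • fderiv ℝ φ (P (r, θ)) 1 +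
        (Real.sin θ : ℂ) • fderiv ℝ φ (P (r, θ)) Complex.I := by
      have : unitCircleMap θ = Real.cos θ • (1 : ℂ) + Real.sin θ • Complex.I := by
        simp [unitCircleMap]
      simp only [hA]
      rw [this, map_add, map_smul, map_smul, coe_real_smul, coe_real_smul]
    have e2 : B (r, θ) = (Real.cos θ : ℂ) • fderiv ℝ φ (P (r, θ)) Complex.I -
        (Real.sin θ : ℂ) • fderiv ℝ φ (P (r, θ)) 1 := by
      have : unitCircleMap θ * Complex.I = Real.cos θ • Complex.I - Real.sin θ • (1 : ℂ) := by
        simp only [unitCircleMap, Complex.real_smul]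
        linear_combination (Real.sin θ : ℂ) * Complex.I_sq
      simp only [hB]
      rw [this, map_sub, map_smul, map_smul, coe_real_smul, coe_real_smul]
    rw [e1, e2]
    have e3 : r • ((P (r, θ))⁻¹ • (fderiv ℝ φ (P (r, θ)) 1 +
      Complex.I • fderiv ℝ φ (P (r, θ)) Complex.I)) = (unitCircleMap θ)⁻¹ •
        (fderiv ℝ φ (P (r, θ)) 1 + Complex.I • fderiv ℝ φ (P (r, θ)) Complex.I) := by
      rw [← coe_real_smul, smul_smul]
      congr 1
      simp only [hP]
      field_simp
    rw [e3, hinv]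
    generalize fderiv ℝ φ (P (r, θ)) 1 = x
    generalize fderiv ℝ φ (P (r, θ)) Complex.I = y
    generalize (Real.cos θ : ℂ) = c
    generalize (Real.sin θ : ℂ) = s
    match_scalars
    · ring
    · linear_combination -s * Complex.I_sq
  rw [← Complex.integral_comp_polarCoord_symm, setIntegral_congr_fun
    (polarCoord.open_target.measurableSet) key]
  change ∫ p in Ioi 0 ×ˢ Ioo (-Real.pi) Real.pi, _ ∂(volume.prod volume) = _
  rw [integral_add (g := fun p ↦ Complex.I • B p) hAi (hBi.smul Complex.I), integral_smul]
  have hpi : -Real.pi ≤ Real.pi := by linarith [Real.pi_pos]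
  -- On each circle `r • B` is the derivative of a periodic function of the angle.
  have hBz : ∫ p in Ioi 0 ×ˢ Ioo (-Real.pi) Real.pi, B p ∂(volume.prod volume) = 0 := by
    rw [setIntegral_prod _ hBi]
    refine setIntegral_eq_zero_of_forall_eq_zero fun r hr ↦ ?_
    have hr' : (0 : ℝ) < r := hr
    have hd : ∀ θ, HasDerivAt (fun θ ↦ φ (P (r, θ))) (r • B (r, θ)) θ := fun θ ↦ by
      have h1 : HasDerivAt (fun θ ↦ P (r, θ)) (r * (unitCircleMap θ * Complex.I)) θ :=
        (hasDerivAt_unitCircleMap θ).const_mul (r : ℂ)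
      have h2 := (hdiff (P (r, θ))).hasFDerivAt.comp_hasDerivAt θ h1
      refine h2.congr_deriv ?_
      rw [hB, ← map_smul, Complex.real_smul]
    have h3 := intervalIntegral.integral_eq_sub_of_hasDerivAt (a := -Real.pi) (b := Real.pi)
      (fun θ _ ↦ hd θ) ((continuous_const.smul (hBc.comp (.prodMk_right r))).intervalIntegrable _ _)
    have h4 : P (r, Real.pi) = P (r, -Real.pi) := by simp [hP, unitCircleMap]
    rw [h4, sub_self, intervalIntegral.integral_smul, intervalIntegral.integral_of_le hpi,
      integral_Ioc_eq_integral_Ioo] at h3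
    exact (smul_eq_zero.1 h3).resolve_left hr'.ne'
  -- On each ray `A` is the derivative of `φ`, which vanishes far out, so every angle contributes
  -- `-φ 0`.
  have hAz : ∫ p in Ioi 0 ×ˢ Ioo (-Real.pi) Real.pi, A p ∂(volume.prod volume) =
      -(2 * Real.pi) • φ 0 := by
    have hAi' := hAi
    rw [IntegrableOn, ← Measure.prod_restrict] at hAi'
    rw [← Measure.prod_restrict, integral_prod_symm _ hAi']
    have h1 : ∀ θ, ∫ r in Ioi 0, A (r, θ) = -φ 0 := fun θ ↦ by
      have hd : ∀ r, HasDerivAt (fun r : ℝ ↦ φ (P (r, θ))) (A (r, θ)) r := fun r ↦ by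
        have h1 : HasDerivAt (fun r : ℝ ↦ P (r, θ)) (unitCircleMap θ) r := by
          simpa using (Complex.ofRealCLM.hasDerivAt (x := r)).mul_const (unitCircleMap θ)
        exact (hdiff (P (r, θ))).hasFDerivAt.comp_hasDerivAt r h1
      have hcomp : Continuous fun r ↦ A (r, θ) := hAc.comp (.prodMk_left θ)
      have hint : IntegrableOn (fun r ↦ A (r, θ)) (Ioi 0) :=
        (hcomp.continuousOn.integrableOn_compact isCompact_Icc).of_forall_sdiff_eq_zero
          (s := Icc 0 R) measurableSet_Ioi fun r hr ↦
            hA0 r θ (not_le.1 fun hle ↦ hr.2 ⟨le_of_lt hr.1, hle⟩)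
      have hlim : Tendsto (fun r : ℝ ↦ φ (P (r, θ))) atTop (𝓝 0) := by
        refine tendsto_const_nhds.congr' ?_
        filter_upwards [eventually_gt_atTop R] with r hr
        exact (hR _ (hPn r θ hr)).1.symm
      rw [integral_Ioi_of_hasDerivAt_of_tendsto' (fun r _ ↦ hd r) hint hlim]
      simp [hP]
    simp only [h1, setIntegral_const]
    rw [Measure.real, Real.volume_Ioo, ENNReal.toReal_ofReal (by linarith), smul_neg, neg_smul]
    congr 2
    ring
  rw [hAz, hBz, smul_zero, add_zero]

end CauchyTransform

/-! ### Smoothness and derivatives of the Cauchy transform. -/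

section DbarPoincare

open MeasureTheory Filter Convolution

variable {E : Type*} [NormedAddCommGroup E] [NormedSpace ℂ E]
  {F : Type*} [NormedAddCommGroup F] [NormedSpace ℝ F] [NormedSpace ℂ F] [IsScalarTower ℝ ℂ F]

/-- The antilinear part of the real derivative of a function, in the direction `u`. -/
def dbarDeriv (f : E → F) (z u : E) : F :=
  (2⁻¹ : ℂ) • (fderiv ℝ f z u + Complex.I • fderiv ℝ f z (Complex.I • u))

/-- The Cauchy kernel on `ℂ`. -/
def cauchyKernel (w : ℂ) : ℂ := ((Real.pi : ℂ) * w)⁻¹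

/-- The singularity `‖w‖⁻¹` has order `1`, below the real dimension `2` of `ℂ`. -/
theorem locallyIntegrable_cauchyKernel : LocallyIntegrable cauchyKernel := by
  refine locallyIntegrable_of_norm_le_rpow (C := Real.pi⁻¹) (α := 1) ?_ ?_ ?_ ?_
  · simp [Complex.finrank_real_complex]
  · simp [Complex.finrank_real_complex]
  · refine .of_forall fun w ↦ ?_
    rw [Real.rpow_neg_one]
    simp [cauchyKernel, abs_of_pos Real.pi_pos, mul_comm]
  · refine Measurable.aestronglyMeasurable ?_
    unfold cauchyKernel
    fun_prop

/-- The Cauchy transform of `f` along the complex line spanned by `b`. -/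
def cauchyTransform (b : E) (f : E → F) (z : E) : F :=
  ∫ w : ℂ, cauchyKernel w • f (z - w • b)

/-- One radius serves all `z` near `z₀`, which is the uniformity needed for convolutions depending
on a parameter. -/
theorem exists_closedBall_line_eq_zero {F : Type*} [NormedAddCommGroup F] {f : E → F} (hc : HasCompactSupport f) {b : E} (hb : b ≠ 0)
    (z₀ : E) : ∃ R : ℝ, ∀ z ∈ Metric.ball z₀ 1, ∀ w ∉ Metric.closedBall (0 : ℂ) R,
      z + w • b ∉ tsupport f := by
  obtain ⟨R, hR⟩ := hc.isCompact.isBounded.subset_closedBall 0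
  refine ⟨(R + ‖z₀‖ + 1) / ‖b‖, fun z hz w hw h ↦ hw ?_⟩
  have h1 := mem_closedBall_zero_iff.1 (hR h)
  have h2 := mem_ball_iff_norm.1 hz
  rw [mem_closedBall_zero_iff, le_div_iff₀ (norm_pos_iff.2 hb), ← norm_smul]
  have h3 := norm_sub_le (z + w • b) z
  rw [add_sub_cancel_left] at h3
  have h4 := norm_le_norm_add_norm_sub' z z₀
  linarith

/-- Treating `z` as a parameter and convolving at `0` leaves the singularity on the kernel and all
the dependence on `z` in the smooth factor, so derivatives fall on `f`. -/
theorem cauchyTransform_eq_convolution (b : E) (f : E → F) (z : E) :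
    cauchyTransform b f z = ((cauchyKernel ⋆[ContinuousLinearMap.lsmul ℝ ℂ, volume]
      fun x : ℂ ↦ f (z + x • b)) 0) := by
  simp [cauchyTransform, convolution_def, sub_eq_add_neg]

theorem contDiff_cauchyTransform {b : E} (hb : b ≠ 0) {f : E → F} (hf : ContDiff ℝ ∞ f)
    (hc : HasCompactSupport f) : ContDiff ℝ ∞ (cauchyTransform b f) := by
  rw [contDiff_iff_contDiffAt]
  intro z₀
  obtain ⟨R, hR⟩ := exists_closedBall_line_eq_zero hc hb z₀
  have h := contDiffOn_convolution_right_with_param (n := ((⊤ : ℕ∞))) (μ := volume)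
    (ContinuousLinearMap.lsmul ℝ ℂ : ℂ →L[ℝ] F →L[ℝ] F)
    (g := fun z x ↦ f (z + x • b)) (s := Metric.ball z₀ 1) Metric.isOpen_ball
    (isCompact_closedBall (0 : ℂ) R)
    (fun z w hz hw ↦ image_eq_zero_of_notMem_tsupport (hR z hz w hw))
    locallyIntegrable_cauchyKernel (ContDiff.contDiffOn (by
      change ContDiff ℝ ∞ fun p : E × ℂ ↦ f (p.1 + p.2 • b)
      exact hf.comp (by fun_prop)))
  have h2 : ContDiffOn ℝ ∞ (cauchyTransform b f) (Metric.ball z₀ 1) := by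
    have h3 : ContDiffOn ℝ ∞ (fun z : E ↦ (z, (0 : ℂ))) (Metric.ball z₀ 1) := by fun_prop
    refine (h.comp h3 fun z hz ↦ ⟨hz, mem_univ _⟩).congr fun z _ ↦ ?_
    exact cauchyTransform_eq_convolution b f z
  exact h2.contDiffAt (Metric.ball_mem_nhds z₀ one_pos)

theorem hasCompactSupport_comp_line {F : Type*} [NormedAddCommGroup F] {f : E → F} (hc : HasCompactSupport f) {b : E} (hb : b ≠ 0)
    (z : E) : HasCompactSupport fun w : ℂ ↦ f (z + w • b) := by
  obtain ⟨R, hR⟩ := exists_closedBall_line_eq_zero hc hb z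
  exact .intro (isCompact_closedBall 0 R) fun w hw ↦
    image_eq_zero_of_notMem_tsupport (hR z (Metric.mem_ball_self one_pos) w hw)

theorem integrable_cauchyKernel_smul {f : E → F} (hf : Continuous f) (hc : HasCompactSupport f)
    {b : E} (hb : b ≠ 0) (z : E) : Integrable fun w : ℂ ↦ cauchyKernel w • f (z - w • b) := by
  have h := hasCompactSupport_comp_line hc (neg_ne_zero.2 hb) z
  simp only [smul_neg, ← sub_eq_add_neg] at h
  exact locallyIntegrable_cauchyKernel.integrable_smul_right_of_hasCompactSupport (by fun_prop) h

theorem fderiv_cauchyTransform [CompleteSpace F] {b : E} (hb : b ≠ 0) {f : E → F} (hf : ContDiff ℝ ∞ f)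
    (hc : HasCompactSupport f) (z v : E) :
    fderiv ℝ (cauchyTransform b f) z v = cauchyTransform b (fun y ↦ fderiv ℝ f y v) z := by
  obtain ⟨R, hR⟩ := exists_closedBall_line_eq_zero hc hb z
  have hg : ContDiff ℝ ∞ fun p : E × ℂ ↦ f (p.1 + p.2 • b) := hf.comp (by fun_prop)
  have h := hasFDerivAt_convolution_right_with_param (μ := volume)
    (ContinuousLinearMap.lsmul ℝ ℂ : ℂ →L[ℝ] F →L[ℝ] F)
    (g := fun z x ↦ f (z + x • b)) (s := Metric.ball z 1) Metric.isOpen_ball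
    (isCompact_closedBall (0 : ℂ) R)
    (fun z w hz hw ↦ image_eq_zero_of_notMem_tsupport (hR z hz w hw))
    locallyIntegrable_cauchyKernel (hg.of_le (by simp)).contDiffOn (z, 0)
    (Metric.mem_ball_self one_pos)
  have h2 : HasFDerivAt (fun z : E ↦ (z, (0 : ℂ))) (ContinuousLinearMap.inl ℝ E ℂ) z :=
    (hasFDerivAt_id z).prodMk (hasFDerivAt_const 0 z)
  have h3 := (HasFDerivAt.comp (g := fun q : E × ℂ ↦ (cauchyKernel
    ⋆[ContinuousLinearMap.lsmul ℝ ℂ, volume] fun x : ℂ ↦ f (q.1 + x • b)) q.2) z h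
    h2).congr_of_eventuallyEq (f₁ := cauchyTransform b f)
    (.of_forall fun y ↦ cauchyTransform_eq_convolution b f y)
  rw [h3.fderiv, cauchyTransform_eq_convolution]
  have hfd : ∀ x : ℂ, fderiv ℝ (fun p : E × ℂ ↦ f (p.1 + p.2 • b)) (z, x) =
      (fderiv ℝ f (z + x • b)).comp (fderiv ℝ (fun p : E × ℂ ↦ p.1 + p.2 • b) (z, x)) := fun x ↦
    fderiv_comp (z, x) (hf.differentiable (by simp) _) (by fun_prop)
  have hsupp : HasCompactSupport fun x : ℂ ↦ fderiv ℝ (fun p : E × ℂ ↦ f (p.1 + p.2 • b)) (z, x) := by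
    refine .intro (isCompact_closedBall (0 : ℂ) R) fun w hw ↦ ?_
    rw [hfd, image_eq_zero_of_notMem_tsupport (f := fderiv ℝ f) fun h ↦
      hR z (Metric.mem_ball_self one_pos) w hw (tsupport_fderiv_subset ℝ h),
      ContinuousLinearMap.zero_comp]
  have hcont : Continuous fun x : ℂ ↦ fderiv ℝ (fun p : E × ℂ ↦ f (p.1 + p.2 • b)) (z, x) :=
    (hg.continuous_fderiv (by simp)).comp (.prodMk_right z)
  have h4 := convolution_precompR_apply (μ := volume)
    (ContinuousLinearMap.lsmul ℝ ℂ : ℂ →L[ℝ] F →L[ℝ] F) locallyIntegrable_cauchyKernel hsupp hcont 0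
    (v, (0 : ℂ))
  refine h4.trans ?_
  congr 2
  funext x
  have h5 : HasFDerivAt (fun p : E × ℂ ↦ p.1 + p.2 • b) (ContinuousLinearMap.fst ℝ E ℂ +
      (ContinuousLinearMap.snd ℝ E ℂ).smulRight b) (z, x) :=
    (ContinuousLinearMap.fst ℝ E ℂ + (ContinuousLinearMap.snd ℝ E ℂ).smulRight b).hasFDerivAt
  rw [hfd, h5.fderiv]
  simp

theorem dbarDeriv_cauchyTransform [CompleteSpace F] {b : E} (hb : b ≠ 0) {f : E → F}
    (hf : ContDiff ℝ ∞ f) (hc : HasCompactSupport f) (z v : E) :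
    dbarDeriv (cauchyTransform b f) z v = cauchyTransform b (fun y ↦ dbarDeriv f y v) z := by
  have hi : ∀ v, Integrable fun w : ℂ ↦ cauchyKernel w • fderiv ℝ f (z - w • b) v := fun v ↦
    integrable_cauchyKernel_smul ((hf.continuous_fderiv (by simp)).clm_apply continuous_const)
      (hc.fderiv_apply ℝ v) hb z
  simp only [dbarDeriv, fderiv_cauchyTransform hb hf hc, cauchyTransform]
  rw [← integral_smul, ← integral_add (g := fun w ↦ Complex.I • cauchyKernel w •
    fderiv ℝ f (z - w • b) (Complex.I • v)) (hi v) ((hi (Complex.I • v)).smul Complex.I),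
    ← integral_smul]
  congr 1
  funext w
  module

/-- The Cauchy transform solves the `∂̄`-equation in one direction. -/
theorem dbarDeriv_cauchyTransform_self [CompleteSpace F] {b : E} (hb : b ≠ 0) {f : E → F}
    (hf : ContDiff ℝ ∞ f) (hc : HasCompactSupport f) (z : E) :
    dbarDeriv (cauchyTransform b f) z b = f z := by
  -- The integrand involves `z - w • b`, so the Cauchy–Pompeiu formula is used along `-b`; this sign
  -- cancels the one in that formula.
  have hφ : ContDiff ℝ 1 fun w : ℂ ↦ f (z + w • -b) := (hf.comp (by fun_prop)).of_le (by simp)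
  have h := integral_inv_smul_fderiv hφ (hasCompactSupport_comp_line hc (neg_ne_zero.2 hb) z)
  have hd : ∀ w v : ℂ, fderiv ℝ (fun w : ℂ ↦ f (z + w • -b)) w v =
      -fderiv ℝ f (z - w • b) (v • b) := fun w v ↦ by
    have h1 : HasFDerivAt (fun w : ℂ ↦ z + w • -b)
        ((ContinuousLinearMap.id ℝ ℂ).smulRight (-b)) w :=
      ((ContinuousLinearMap.id ℝ ℂ).smulRight (-b)).hasFDerivAt.const_add z
    have h2 := ((hf.differentiable (by simp) (z + w • -b)).hasFDerivAt.comp w h1).fderiv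
    have h3 := congrArg (fun L ↦ L v) h2
    simp only [ContinuousLinearMap.comp_apply] at h3
    rw [show z - w • b = z + w • -b by module, ← map_neg]
    refine h3.trans (congrArg _ ?_)
    simp
  simp only [hd, one_smul, zero_smul, add_zero] at h
  rw [dbarDeriv_cauchyTransform hb hf hc, cauchyTransform]
  have h4 : ∀ w : ℂ, cauchyKernel w • dbarDeriv f (z - w • b) b = (-(2 * Real.pi : ℂ)⁻¹) •
      (w⁻¹ • (-fderiv ℝ f (z - w • b) b +
        Complex.I • -fderiv ℝ f (z - w • b) (Complex.I • b))) := fun w ↦ by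
    simp only [dbarDeriv, cauchyKernel, mul_inv]
    module
  simp only [h4]
  rw [integral_smul, h, ← coe_real_smul, smul_smul]
  have : -(2 * (Real.pi : ℂ))⁻¹ * ((-(2 * Real.pi) : ℝ) : ℂ) = 1 := by
    have : (Real.pi : ℂ) ≠ 0 := by exact_mod_cast Real.pi_ne_zero
    push_cast
    field_simp
  rw [this, one_smul]

end DbarPoincare

/-! ### The `∂̄`-Poincaré lemma for vector-valued `(0,1)`-forms. -/

section DbarPoincare

open Filter

variable {E : Type*} [NormedAddCommGroup E] [NormedSpace ℂ E]
  {F : Type*} [NormedAddCommGroup F] [NormedSpace ℝ F] [NormedSpace ℂ F] [IsScalarTower ℝ ℂ F]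

theorem dbarDeriv_congr {f g : E → F} {z : E} (h : f =ᶠ[𝓝 z] g) (u : E) :
    dbarDeriv f z u = dbarDeriv g z u := by
  simp only [dbarDeriv, h.fderiv_eq]

theorem dbarDeriv_add {f g : E → F} {z : E} (hf : DifferentiableAt ℝ f z)
    (hg : DifferentiableAt ℝ g z) (u : E) :
    dbarDeriv (fun y ↦ f y + g y) z u = dbarDeriv f z u + dbarDeriv g z u := by
  simp only [dbarDeriv, fderiv_fun_add hf hg, _root_.add_apply]
  module

theorem dbarDeriv_sub {f g : E → F} {z : E} (hf : DifferentiableAt ℝ f z)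
    (hg : DifferentiableAt ℝ g z) (u : E) :
    dbarDeriv (fun y ↦ f y - g y) z u = dbarDeriv f z u - dbarDeriv g z u := by
  simp only [dbarDeriv, fderiv_fun_sub hf hg, _root_.sub_apply]
  module

/-- `dbarDeriv` as a real linear map. -/
def dbarCLM (f : E → F) (z : E) : E →L[ℝ] F :=
  (2⁻¹ : ℂ) • (fderiv ℝ f z + Complex.I • (fderiv ℝ f z).comp
    ((Complex.I • ContinuousLinearMap.id ℂ E).restrictScalars ℝ))

theorem dbarCLM_apply (f : E → F) (z u : E) : dbarCLM f z u = dbarDeriv f z u := rfl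

theorem dbarDeriv_eq_zero_of_I_smul {f : E → F} {z u : E}
    (h : Complex.I • fderiv ℝ f z u = fderiv ℝ f z (Complex.I • u)) : dbarDeriv f z u = 0 := by
  rw [dbarDeriv, ← h, smul_smul, Complex.I_mul_I, neg_smul, one_smul, add_neg_cancel, smul_zero]

theorem dbarDeriv_I_smul (f : E → F) (z u : E) :
    dbarDeriv f z (Complex.I • u) = -(Complex.I • dbarDeriv f z u) := by
  simp only [dbarDeriv, smul_smul, Complex.I_mul_I, neg_smul, one_smul, map_neg]
  match_scalars
  · linear_combination (2⁻¹ : ℂ) * Complex.I_sq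
  · ring

theorem contDiffAt_dbarCLM {f : E → F} {z : E} (hf : ContDiffAt ℝ ∞ f z) :
    ContDiffAt ℝ ∞ (dbarCLM f) z := by
  have h : ContDiffAt ℝ ∞ (fderiv ℝ f) z := hf.fderiv_right (by simp)
  exact (h.add ((h.clm_comp contDiffAt_const).const_smul Complex.I)).const_smul _

/-- This is `∂̄² = 0`, a consequence of the symmetry of second derivatives. -/
theorem dbarDeriv_dbarDeriv_comm {f : E → F} {z : E} (hf : ContDiffAt ℝ ∞ f z) (u v : E) :
    dbarDeriv (fun y ↦ dbarDeriv f y v) z u = dbarDeriv (fun y ↦ dbarDeriv f y u) z v := by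
  have hd : DifferentiableAt ℝ (fderiv ℝ f) z :=
    (hf.fderiv_right (m := ∞) (by simp)).differentiableAt (by simp)
  have hsymm : ∀ u v, fderiv ℝ (fderiv ℝ f) z u v = fderiv ℝ (fderiv ℝ f) z v u := fun u v ↦
    (hf.isSymmSndFDerivAt (by simpa using WithTop.coe_le_coe.2 (le_top : (2 : ℕ∞) ≤ ⊤))).eq u v
  have key : ∀ v u, fderiv ℝ (fun y ↦ dbarDeriv f y v) z u = (2⁻¹ : ℂ) •
      (fderiv ℝ (fderiv ℝ f) z u v + Complex.I • fderiv ℝ (fderiv ℝ f) z u (Complex.I • v)) := by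
    intro v u
    have h1 : ∀ v, HasFDerivAt (fun y ↦ fderiv ℝ f y v)
        ((fderiv ℝ (fderiv ℝ f) z).flip v) z := fun v ↦ by
      simpa using hd.hasFDerivAt.clm_apply (hasFDerivAt_const v z)
    have h2 := ((h1 v).add ((h1 (Complex.I • v)).const_smul Complex.I)).const_smul (2⁻¹ : ℂ)
    exact congrArg (fun L ↦ L u) h2.fderiv
  simp only [dbarDeriv] at key
  simp only [dbarDeriv, key]
  rw [hsymm u v, hsymm u (Complex.I • v), hsymm (Complex.I • u) v,
    hsymm (Complex.I • u) (Complex.I • v)]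
  module

theorem contDiffAt_cutoff {φ : E → ℝ} (hφ : ContDiff ℝ ∞ φ) {h : E → F} {K : Set E}
    (hK : tsupport φ ⊆ K) (hh : ∀ z ∈ K, ContDiffAt ℝ ∞ h z) :
    ContDiff ℝ ∞ fun z ↦ φ z • h z := by
  refine contDiff_iff_contDiffAt.2 fun z ↦ ?_
  by_cases hz : z ∈ tsupport φ
  · exact hφ.contDiffAt.smul (hh z (hK hz))
  · refine (contDiffAt_const (c := (0 : F))).congr_of_eventuallyEq ?_
    filter_upwards [notMem_tsupport_iff_eventuallyEq.1 hz] with y hy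
    simp [hy]

/-- Local solution of the `∂̄`-equation in one direction, preserving holomorphy in the others. -/
theorem exists_dbarDeriv_eq [FiniteDimensional ℂ E] [CompleteSpace F] {x₀ b : E}
    (l : E →L[ℂ] ℂ) (hl : l b = 1) {h : E → F} (hh : ∀ᶠ z in 𝓝 x₀, ContDiffAt ℝ ∞ h z) {S : Set E}
    (hS : ∀ v ∈ S, l v = 0) (hhS : ∀ᶠ z in 𝓝 x₀, ∀ v ∈ S, dbarDeriv h z v = 0) :
    ∃ u : E → F, ContDiff ℝ ∞ u ∧ (∀ᶠ z in 𝓝 x₀, dbarDeriv u z b = h z) ∧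
      ∀ᶠ z in 𝓝 x₀, ∀ v ∈ S, dbarDeriv u z v = 0 := by
  have : ProperSpace E := FiniteDimensional.proper ℂ E
  have : FiniteDimensional ℝ E := FiniteDimensional.complexToReal E
  have hb : b ≠ 0 := by
    rintro rfl
    simp at hl
  obtain ⟨δ, hδ, hW⟩ := Metric.nhds_basis_closedBall.eventually_iff.1 (hh.and hhS)
  -- The cutoff is a product of a bump in the coordinate `l` and a bump in the complementary
  -- projection `P`, because a general cutoff would spoil `∂̄_v = 0` for `v ∈ S`. Each outer radius
  -- contributes at most `δ / 2`, so the product is supported within `δ` of `x₀`.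
  let χ : ContDiffBump (0 : ℂ) :=
    ⟨δ / (4 * (‖b‖ + 1)), δ / (2 * (‖b‖ + 1)), by positivity, by gcongr; norm_num⟩
  let ψ : ContDiffBump (0 : E) := ⟨δ / 4, δ / 2, by positivity, by linarith⟩
  set P : E → E := fun z ↦ (z - x₀) - l (z - x₀) • b with hP
  have hPc : ContDiff ℝ ∞ P := by
    have : ContDiff ℝ ∞ l := l.restrictScalars ℝ |>.contDiff
    fun_prop
  set χ' : E → ℝ := fun z ↦ χ (l (z - x₀)) with hχ'
  have hχ'c : ContDiff ℝ ∞ χ' :=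
    χ.contDiff.comp ((l.restrictScalars ℝ).contDiff.comp (contDiff_id.sub contDiff_const))
  set φ : E → ℝ := fun z ↦ χ' z * ψ (P z) with hφ
  have hφc : ContDiff ℝ ∞ φ := hχ'c.mul (ψ.contDiff.comp hPc)
  have hsupp : tsupport φ ⊆ Metric.closedBall x₀ δ := by
    refine closure_minimal (fun z hz ↦ ?_) Metric.isClosed_closedBall
    have h1 : l (z - x₀) ∈ Function.support χ := left_ne_zero_of_mul hz
    have h2 : P z ∈ Function.support ψ := right_ne_zero_of_mul hz
    rw [χ.support_eq, mem_ball_zero_iff] at h1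
    rw [ψ.support_eq, mem_ball_zero_iff] at h2
    rw [mem_closedBall_iff_norm]
    have h3 : z - x₀ = P z + l (z - x₀) • b := by simp [hP]
    have h4 : ‖l (z - x₀) • b‖ ≤ δ / 2 := by
      rw [norm_smul]
      calc ‖l (z - x₀)‖ * ‖b‖ ≤ δ / (2 * (‖b‖ + 1)) * (‖b‖ + 1) := by
            gcongr
            linarith
        _ = δ / 2 := by field_simp
    have h5 : ‖P z‖ < δ / 2 := h2
    rw [h3]
    exact (norm_add_le _ _).trans (by linarith)
  set f : E → F := fun z ↦ φ z • h z with hf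
  have hfc : ContDiff ℝ ∞ f := contDiffAt_cutoff hφc hsupp fun z hz ↦ (hW hz).1
  have hfs : tsupport f ⊆ Metric.closedBall x₀ δ := (tsupport_smul_subset_left φ h).trans hsupp
  have hfcomp : HasCompactSupport f :=
    (isCompact_closedBall x₀ δ).of_isClosed_subset (isClosed_tsupport f) hfs
  refine ⟨cauchyTransform b f, contDiff_cauchyTransform hb hfc hfcomp, ?_, ?_⟩
  · have h1 : ∀ᶠ z in 𝓝 x₀, χ' z = 1 := by
      have hc : Tendsto (fun z ↦ l (z - x₀)) (𝓝 x₀) (𝓝 0) := by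
        have : Continuous fun z ↦ l (z - x₀) := by fun_prop
        simpa using this.tendsto x₀
      exact hc.eventually χ.eventuallyEq_one
    have h2 : ∀ᶠ z in 𝓝 x₀, ψ (P z) = 1 := by
      have hc : Tendsto P (𝓝 x₀) (𝓝 0) := by simpa [hP] using hPc.continuous.tendsto x₀
      exact hc.eventually ψ.eventuallyEq_one
    filter_upwards [h1, h2] with z hz1 hz2
    rw [dbarDeriv_cauchyTransform_self hb hfc hfcomp]
    simp [hf, hφ, hz1, hz2]
  · have h1 : ∀ᶠ z in 𝓝 x₀, P z ∈ Metric.ball (0 : E) (δ / 4) := by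
      have hc : Tendsto P (𝓝 x₀) (𝓝 0) := by simpa [hP] using hPc.continuous.tendsto x₀
      exact hc.eventually (Metric.ball_mem_nhds _ (by positivity))
    filter_upwards [h1] with z hz v hv
    rw [dbarDeriv_cauchyTransform hb hfc hfcomp]
    refine MeasureTheory.integral_eq_zero_of_ae (.of_forall fun w ↦ ?_)
    suffices dbarDeriv f (z - w • b) v = 0 by simp [this]
    set y := z - w • b with hy
    by_cases hys : y ∈ tsupport f
    swap
    · have h0 : fderiv ℝ f y = 0 :=
        image_eq_zero_of_notMem_tsupport fun hmem ↦ hys (tsupport_fderiv_subset ℝ hmem)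
      simp [dbarDeriv, h0]
    -- `P` is constant along `b`, so near every point of the line of integration the factor `ψ ∘ P`
    -- is `1`. The remaining factor depends on `l` alone, and its derivative vanishes in the
    -- directions of `S`, which `l` kills.
    have hPy : P y = P z := by
      simp only [hP, hy, map_sub, map_smul, hl, smul_eq_mul, mul_one]
      module
    have hev : f =ᶠ[𝓝 y] fun y ↦ χ' y • h y := by
      have : ∀ᶠ y' in 𝓝 y, P y' ∈ Metric.ball (0 : E) (δ / 4) :=
        hPc.continuous.continuousAt.eventually (Metric.isOpen_ball.mem_nhds (hPy ▸ hz))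
      filter_upwards [this] with y' hy'
      have : ψ (P y') = 1 := ψ.one_of_mem_closedBall (Metric.ball_subset_closedBall hy')
      simp [hf, hφ, this]
    rw [dbarDeriv_congr hev]
    obtain ⟨hy1, hy2⟩ := hW (hfs hys)
    have hχd : ∀ v, l v = 0 → fderiv ℝ χ' y v = 0 := fun v hv ↦ by
      have h1 : HasFDerivAt (fun z ↦ l (z - x₀)) (l.restrictScalars ℝ) y :=
        (l.restrictScalars ℝ).hasFDerivAt.comp y ((hasFDerivAt_id y).sub_const x₀)
      have h2 := ((χ.contDiff (n := 1)).differentiable one_ne_zero (l (y - x₀))).hasFDerivAt.comp y h1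
      rw [show fderiv ℝ χ' y = _ from h2.fderiv]
      simp [hv]
    have hh' : DifferentiableAt ℝ h y := hy1.differentiableAt (by simp)
    have hχ'' : DifferentiableAt ℝ χ' y := hχ'c.differentiable (by simp) y
    simp only [dbarDeriv, fderiv_fun_smul hχ'' hh', _root_.add_apply,
      _root_.smul_apply, ContinuousLinearMap.smulRight_apply,
      hχd v (hS v hv), hχd (Complex.I • v) (by rw [map_smul, hS v hv, smul_zero]), zero_smul, add_zero]
    have := hy2 v hv
    simp only [dbarDeriv] at this
    rw [smul_comm Complex.I (χ' y), ← smul_add, smul_comm, this, smul_zero]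

/-- An antilinear map is thus determined by its values on a complex basis. -/
theorem antilinear_smul {A : E →L[ℝ] F} (hA : ∀ u, A (Complex.I • u) = -(Complex.I • A u))
    (c : ℂ) (u : E) : A (c • u) = starRingEnd ℂ c • A u := by
  have h : c • u = c.re • u + c.im • (Complex.I • u) := by
    rw [← Complex.coe_smul, ← Complex.coe_smul, smul_smul, ← add_smul, Complex.re_add_im]
  rw [h, map_add, map_smul, map_smul, hA, ← coe_real_smul, ← coe_real_smul]
  conv_rhs => rw [← Complex.re_add_im c]
  simp only [map_add, map_mul, Complex.conj_ofReal, Complex.conj_I]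
  module

/-- The **`∂̄`-Poincaré lemma** (Dolbeault–Grothendieck lemma) for smooth `(0,1)`-forms. -/
theorem exists_dbarDeriv_eq_of_closed [FiniteDimensional ℂ E] [CompleteSpace F] {x₀ : E}
    {g : E → E →L[ℝ] F} (hg : ∀ᶠ z in 𝓝 x₀, ContDiffAt ℝ ∞ g z)
    (hanti : ∀ᶠ z in 𝓝 x₀, ∀ u, g z (Complex.I • u) = -(Complex.I • g z u))
    (hclosed : ∀ᶠ z in 𝓝 x₀, ∀ u v,
      dbarDeriv (fun y ↦ g y v) z u = dbarDeriv (fun y ↦ g y u) z v) :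
    ∃ f : E → F, (∀ᶠ z in 𝓝 x₀, ContDiffAt ℝ ∞ f z) ∧
      ∀ᶠ z in 𝓝 x₀, ∀ u, dbarDeriv f z u = g z u := by
  let b := Module.finBasis ℂ E
  -- Induction on the number `k` of antiholomorphic directions in which `g` may be nonzero. For `k =
  -- 0` antilinearity gives `g = 0`; for `k` the full dimension the extra condition is void.
  suffices H : ∀ (k : ℕ) (g : E → E →L[ℝ] F), (∀ᶠ z in 𝓝 x₀, ContDiffAt ℝ ∞ g z) →
      (∀ᶠ z in 𝓝 x₀, ∀ u, g z (Complex.I • u) = -(Complex.I • g z u)) →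
      (∀ᶠ z in 𝓝 x₀, ∀ u v, dbarDeriv (fun y ↦ g y v) z u = dbarDeriv (fun y ↦ g y u) z v) →
      (∀ᶠ z in 𝓝 x₀, ∀ j : Fin (Module.finrank ℂ E), k ≤ j → g z (b j) = 0) →
      ∃ f : E → F, (∀ᶠ z in 𝓝 x₀, ContDiffAt ℝ ∞ f z) ∧
        ∀ᶠ z in 𝓝 x₀, ∀ u, dbarDeriv f z u = g z u by
    exact H (Module.finrank ℂ E) g hg hanti hclosed
      (.of_forall fun z j hj ↦ absurd j.2 (not_lt.2 hj))
  intro k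
  induction k with
  | zero =>
    intro g _ hanti _ h0
    refine ⟨fun _ ↦ 0, .of_forall fun z ↦ contDiffAt_const, ?_⟩
    filter_upwards [hanti, h0] with z hz hz0 u
    have : g z u = 0 := by
      rw [← b.sum_repr u, map_sum]
      exact Finset.sum_eq_zero fun j _ ↦ by
        rw [antilinear_smul hz, hz0 j (Nat.zero_le _), smul_zero]
    simp [dbarDeriv, this]
  | succ k ih =>
    intro g hg hanti hclosed h0
    by_cases hk : k < Module.finrank ℂ E
    swap
    · exact ih g hg hanti hclosed (.of_forall fun z j hj ↦ absurd (hj.trans_lt j.2) hk)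
    set i : Fin (Module.finrank ℂ E) := ⟨k, hk⟩ with hi
    have hgs : ∀ v, ∀ᶠ z in 𝓝 x₀, ContDiffAt ℝ ∞ (fun y ↦ g y v) z := fun v ↦ by
      filter_upwards [hg] with z hz
      exact hz.clm_apply contDiffAt_const
    -- The function `u` absorbs the component of `g` in the last remaining direction without
    -- creating components in the later ones, so `g - ∂̄u` satisfies the hypothesis for `k`.
    obtain ⟨u, hu, hub, huS⟩ := exists_dbarDeriv_eq (x₀ := x₀) (b := b i)
      (LinearMap.toContinuousLinearMap (b.coord i)) (by simp) (hgs (b i))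
      (S := {v | ∃ j : Fin (Module.finrank ℂ E), k + 1 ≤ (j : ℕ) ∧ v = b j}) (by
        rintro _ ⟨j, hj, rfl⟩
        have hne : j ≠ i := by
          rintro rfl
          simp [hi] at hj
        simp [hne]) (by
        -- Closedness turns `∂̄_{b j} (g (b i))` into `∂̄_{b i} (g (b j))`, which is zero because `g
        -- (b j)` vanishes in a neighbourhood.
        filter_upwards [hclosed, h0.eventually_nhds] with z hz hz0
        rintro _ ⟨j, hj, rfl⟩
        rw [hz, dbarDeriv_congr (g := fun _ ↦ 0)]
        · simp [dbarDeriv]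
        · filter_upwards [hz0] with y hy using hy j hj)
    obtain ⟨f, hf, hfg⟩ := ih (fun z ↦ g z - dbarCLM u z) (by
        filter_upwards [hg] with z hz
        exact hz.sub (contDiffAt_dbarCLM hu.contDiffAt)) (by
        filter_upwards [hanti] with z hz v
        simp only [_root_.sub_apply, dbarCLM_apply, hz, dbarDeriv_I_smul]
        module) (by
        filter_upwards [hclosed, hg] with z hz hgz v w
        have hd : ∀ v, DifferentiableAt ℝ (fun y ↦ g y v) z := fun v ↦
          (hgz.clm_apply contDiffAt_const).differentiableAt (by simp)
        have hd' : ∀ v, DifferentiableAt ℝ (fun y ↦ dbarDeriv u y v) z := fun v ↦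
          ((contDiffAt_dbarCLM hu.contDiffAt).clm_apply contDiffAt_const).differentiableAt (by simp)
        simp only [_root_.sub_apply, dbarCLM_apply]
        rw [dbarDeriv_sub (hd _) (hd' _), dbarDeriv_sub (hd _) (hd' _), hz v w,
          dbarDeriv_dbarDeriv_comm hu.contDiffAt]) (by
        filter_upwards [h0, hub, huS] with z hz1 hz2 hz3 j hj
        simp only [_root_.sub_apply, dbarCLM_apply]
        rcases hj.eq_or_lt with hj | hj
        · obtain rfl : j = i := Fin.ext hj.symm
          rw [hz2, sub_self]
        · rw [hz1 j hj, hz3 _ ⟨j, hj, rfl⟩, sub_self])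
    refine ⟨fun z ↦ f z + u z, ?_, ?_⟩
    · filter_upwards [hf] with z hz using hz.add hu.contDiffAt
    · filter_upwards [hf, hfg] with z hz hz2 v
      rw [dbarDeriv_add (hz.differentiableAt (by simp)) (hu.differentiable (by simp) z), hz2 v]
      simp [dbarCLM_apply]

end DbarPoincare

/-! ### Holomorphic extension of real analytic functions of real variables. -/

section Complexification

open Filter

variable {F : Type*} [NormedAddCommGroup F] [NormedSpace ℝ F] [NormedSpace ℂ F]
  [IsScalarTower ℝ ℂ F]

/-- The complex multilinear extension to `ι → ℂ` of a real multilinear map on `ι → ℝ`. -/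
def multilinearExtension {ι : Type*} [Fintype ι] [DecidableEq ι] {n : ℕ}
    (p : (ι → ℝ) [×n]→L[ℝ] F) : (ι → ℂ) [×n]→L[ℂ] F :=
  ∑ σ : Fin n → ι, (((ContinuousMultilinearMap.mkPiAlgebra ℂ (Fin n) ℂ).compContinuousLinearMap
    fun i ↦ ContinuousLinearMap.proj (R := ℂ) (φ := fun _ : ι ↦ ℂ) (σ i)).smulRight
      (p fun i ↦ Pi.single (σ i) 1))

theorem multilinearExtension_apply {ι : Type*} [Fintype ι] [DecidableEq ι] {n : ℕ}
    (p : (ι → ℝ) [×n]→L[ℝ] F) (w : Fin n → ι → ℂ) :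
    multilinearExtension p w = ∑ σ : Fin n → ι, (∏ i, w i (σ i)) • p fun i ↦ Pi.single (σ i) 1 := by
  simp [multilinearExtension]

theorem multilinearExtension_ofReal {ι : Type*} [Fintype ι] [DecidableEq ι] {n : ℕ}
    (p : (ι → ℝ) [×n]→L[ℝ] F) (x : Fin n → ι → ℝ) :
    multilinearExtension p (fun i j ↦ (x i j : ℂ)) = p x := by
  have hx : x = fun i ↦ ∑ j, x i j • (Pi.single j 1 : ι → ℝ) := by
    ext i j
    simp [Finset.sum_apply, Pi.single_apply]
  conv_rhs => rw [hx, ContinuousMultilinearMap.map_sum]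
  rw [multilinearExtension_apply]
  refine Finset.sum_congr rfl fun σ _ ↦ ?_
  rw [p.map_smul_univ (fun i ↦ x i (σ i)) (fun i ↦ Pi.single (σ i) 1), ← coe_real_smul]
  push_cast
  rfl

/-- There are `card ι ^ n` terms, each bounded by `‖p‖`. Growth that is only geometric in `n` keeps
the radius of convergence positive. -/
theorem norm_multilinearExtension_le {ι : Type*} [Fintype ι] [DecidableEq ι] {n : ℕ}
    (p : (ι → ℝ) [×n]→L[ℝ] F) :
    ‖multilinearExtension p‖ ≤ (Fintype.card ι : ℝ) ^ n * ‖p‖ := by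
  refine ContinuousMultilinearMap.opNorm_le_bound (by positivity) fun w ↦ ?_
  rw [multilinearExtension_apply]
  have key : ∀ σ : Fin n → ι, ‖(∏ i, w i (σ i)) • p fun i ↦ Pi.single (σ i) 1‖ ≤
      ‖p‖ * ∏ i, ‖w i‖ := by
    intro σ
    rw [norm_smul, norm_prod, mul_comm]
    refine mul_le_mul ?_ ?_ (by positivity) (by positivity)
    · refine (p.le_opNorm _).trans_eq ?_
      simp [Pi.norm_single]
    · exact Finset.prod_le_prod (fun _ _ ↦ norm_nonneg _) fun i _ ↦ norm_le_pi_norm (w i) (σ i)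
  refine (norm_sum_le_of_le _ fun σ _ ↦ key σ).trans_eq ?_
  simp [mul_assoc]

/-- A real analytic function on `ι → ℝ` extends locally to a holomorphic function on `ι → ℂ`. -/
theorem exists_analyticAt_extension {ι : Type*} [Fintype ι] [CompleteSpace F] {h : (ι → ℝ) → F}
    (hh : AnalyticAt ℝ h 0) : ∃ G : (ι → ℂ) → F, AnalyticAt ℂ G 0 ∧
      ∀ᶠ x in 𝓝 (0 : ι → ℝ), G (fun j ↦ (x j : ℂ)) = h x := by
  classical
  obtain ⟨p, r, hp⟩ := hh
  obtain ⟨s, hs0, hsr⟩ := ENNReal.lt_iff_exists_nnreal_btwn.1 hp.r_pos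
  have hs0' : 0 < s := by exact_mod_cast hs0
  obtain ⟨M, hM, hMs⟩ := p.norm_mul_pow_le_of_lt_radius (hsr.trans_le hp.r_le)
  set q : FormalMultilinearSeries ℂ (ι → ℂ) F := fun n ↦ multilinearExtension (p n) with hq
  -- Dividing by the number of variables absorbs the factor `card ι ^ n`; the `+ 1` covers an empty
  -- index type.
  set t : NNReal := s / (Fintype.card ι + 1) with ht
  have ht0 : 0 < t := by positivity
  have hts : (Fintype.card ι : ℝ) * t ≤ s := by
    rw [ht]
    push_cast
    rw [mul_div_assoc', div_le_iff₀ (by positivity)]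
    nlinarith [s.2]
  have hrad : (t : ENNReal) ≤ q.radius := by
    refine q.le_radius_of_bound M fun n ↦ ?_
    calc ‖q n‖ * (t : ℝ) ^ n ≤ ((Fintype.card ι : ℝ) ^ n * ‖p n‖) * (t : ℝ) ^ n := by
          gcongr
          exact norm_multilinearExtension_le (p n)
      _ = ‖p n‖ * ((Fintype.card ι : ℝ) * t) ^ n := by rw [mul_pow]; ring
      _ ≤ ‖p n‖ * (s : ℝ) ^ n := by gcongr
      _ ≤ M := hMs n
  have hqpos : 0 < q.radius := lt_of_lt_of_le (by exact_mod_cast ht0) hrad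
  have hG := q.hasFPowerSeriesOnBall hqpos
  refine ⟨q.sum, hG.analyticAt, ?_⟩
  filter_upwards [Metric.eball_mem_nhds (0 : ι → ℝ) hp.r_pos] with x hx
  have h1 := (hp.hasSum hx).tsum_eq
  rw [zero_add] at h1
  rw [← h1, FormalMultilinearSeries.sum]
  exact tsum_congr fun n ↦ multilinearExtension_ofReal (p n) fun _ ↦ x

variable {E : Type*} [NormedAddCommGroup E] [NormedSpace ℂ E]

end Complexification

/-! ### The totally real subspace of all `(y, conj y)`: extension and uniqueness. -/

section Conjugation

open Filter

variable {E : Type*} [NormedAddCommGroup E] [NormedSpace ℂ E] [FiniteDimensional ℂ E]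
  {ι : Type*} [Fintype ι] (b : Module.Basis ι ℂ E)

/-- The coordinate functions of a basis. -/
def coordCLM (j : ι) : E →L[ℂ] ℂ := LinearMap.toContinuousLinearMap (b.coord j)

@[simp]

theorem coordCLM_apply (j : ι) (y : E) : coordCLM b j y = b.repr y j := rfl

/-- Complex conjugation of the coordinates with respect to a basis. -/
def conjCLM : E →L[ℝ] E :=
  LinearMap.toContinuousLinearMap
    { toFun := fun y ↦ ∑ j, (starRingEnd ℂ) (b.repr y j) • b j
      map_add' := fun y z ↦ by simp [add_smul, Finset.sum_add_distrib]
      map_smul' := fun r y ↦ by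
        have h (j : ι) : b.repr (r • y) j = (r : ℂ) * b.repr y j := by
          rw [← coe_real_smul, map_smul]
          rfl
        simp [h, Finset.smul_sum, mul_smul] }

theorem conjCLM_apply (y : E) : conjCLM b y = ∑ j, (starRingEnd ℂ) (b.repr y j) • b j := rfl

@[simp]
theorem repr_conjCLM (y : E) (j : ι) :
    b.repr (conjCLM b y) j = (starRingEnd ℂ) (b.repr y j) := by
  classical
  rw [conjCLM_apply, map_sum, Finsupp.finsetSum_apply]
  simp [Finsupp.single_apply]

@[simp]
theorem conjCLM_conjCLM (y : E) : conjCLM b (conjCLM b y) = y :=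
  b.ext_elem fun j ↦ by simp

@[simp]
theorem conjCLM_smul (c : ℂ) (y : E) :
    conjCLM b (c • y) = (starRingEnd ℂ) c • conjCLM b y :=
  b.ext_elem fun j ↦ by simp

variable {F : Type*} [NormedAddCommGroup F] [NormedSpace ℝ F] [NormedSpace ℂ F]
  [IsScalarTower ℝ ℂ F]

/-- A real analytic function on `E` extends to a holomorphic function on `E × E`, in which `E` is
embedded by `y ↦ (y, conj y)`. -/
theorem exists_analyticAt_complexification [CompleteSpace F] {γ : E → F} (hγ : AnalyticAt ℝ γ 0) :
    ∃ G : E × E → F, AnalyticAt ℂ G 0 ∧ ∀ᶠ y in 𝓝 (0 : E), G (y, conjCLM b y) = γ y := by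
  set A : (ι ⊕ ι → ℝ) →L[ℝ] E := ∑ j,
    ((ContinuousLinearMap.proj (R := ℝ) (φ := fun _ : ι ⊕ ι ↦ ℝ) (.inl j)).smulRight (b j) +
    (ContinuousLinearMap.proj (R := ℝ) (φ := fun _ : ι ⊕ ι ↦ ℝ) (.inr j)).smulRight
      (Complex.I • b j)) with hA
  have hAapply (x : ι ⊕ ι → ℝ) :
      A x = ∑ j, ((x (.inl j) : ℂ) + x (.inr j) * Complex.I) • b j := by
    simp [hA, add_smul, mul_smul]
  obtain ⟨G, hG, hGeq⟩ := exists_analyticAt_extension (h := γ ∘ A)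
    (AnalyticAt.comp (by simpa using hγ) (A.analyticAt 0))
  -- In coordinates these are `(z + ζ) / 2` and `(z - ζ) / (2 i)`, the real and imaginary parts of
  -- `z` when `ζ = conj z`.
  set L : E × E →L[ℂ] (ι ⊕ ι → ℂ) := ContinuousLinearMap.pi (Sum.elim
    (fun j ↦ (2⁻¹ : ℂ) • ((coordCLM b j).comp (.fst ℂ E E) + (coordCLM b j).comp (.snd ℂ E E)))
    (fun j ↦ (-(Complex.I / 2) : ℂ) •
      ((coordCLM b j).comp (.fst ℂ E E) - (coordCLM b j).comp (.snd ℂ E E)))) with hL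
  refine ⟨G ∘ L, AnalyticAt.comp (by simpa using hG) (L.analyticAt 0), ?_⟩
  set B : E → (ι ⊕ ι → ℝ) := fun y ↦ Sum.elim (fun j ↦ (b.repr y j).re) (fun j ↦ (b.repr y j).im)
    with hB
  have hBc : Continuous B := by
    refine continuous_pi ?_
    rintro (j | j)
    · exact Complex.continuous_re.comp (coordCLM b j).continuous
    · exact Complex.continuous_im.comp (coordCLM b j).continuous
  have hB0 : Tendsto B (𝓝 0) (𝓝 0) := by
    have := hBc.tendsto 0
    convert this
    ext (j | j) <;> simp [hB]
  filter_upwards [hB0.eventually hGeq] with y hy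
  have hAB : A (B y) = y := by
    rw [hAapply]
    simp only [hB, Sum.elim_inl, Sum.elim_inr, Complex.re_add_im]
    exact b.sum_repr y
  have hLB : L (y, conjCLM b y) = fun j ↦ (B y j : ℂ) := by
    ext (j | j)
    · simp only [hL, hB, ContinuousLinearMap.coe_pi', Sum.elim_inl]
      apply Complex.ext <;> simp
      ring
    · simp only [hL, hB, ContinuousLinearMap.coe_pi', Sum.elim_inr]
      apply Complex.ext <;> simp
      ring
  simp only [Function.comp_apply, hLB, hy, hAB]

/-- A holomorphic function on `E × E` which vanishes on the totally real subspace of all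
`(y, conj y)` near the origin vanishes near the origin. -/
theorem eventually_eq_zero_of_conj {F : Type*} [NormedAddCommGroup F] [NormedSpace ℂ F]
    [CompleteSpace F] {D : E × E → F} (hD : AnalyticAt ℂ D 0)
    (h0 : ∀ᶠ y in 𝓝 (0 : E), D (y, conjCLM b y) = 0) : ∀ᶠ p in 𝓝 (0 : E × E), D p = 0 := by
  set C := conjCLM b with hC
  -- Every `p` lies on the complex line `w p`, which is in the totally real subspace for real `t`
  -- and reaches `p` at `t = i`. The identity theorem on this line transports the vanishing from
  -- real `t` to `t = i`; the disc of radius `2` contains both.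
  set a : E × E → E := fun p ↦ (2⁻¹ : ℂ) • (p.1 + C p.2) with ha
  set c : E × E → E := fun p ↦ (-(Complex.I / 2) : ℂ) • (p.1 - C p.2) with hc
  set w : E × E → ℂ → E × E := fun p t ↦ (a p, C (a p)) + t • (c p, C (c p)) with hw
  have hac : Continuous a := by fun_prop
  have hcc : Continuous c := by fun_prop
  have hwc : Continuous fun q : (E × E) × ℂ ↦ w q.1 q.2 := by fun_prop
  have hw0 : ∀ t, w 0 t = 0 := fun t ↦ by simp [hw, ha, hc]
  have hreal : ∀ p (r : ℝ), w p r = (a p + r • c p, C (a p + r • c p)) := fun p r ↦ by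
    simp [hw]
  have hI : ∀ p, w p Complex.I = p := by
    rintro ⟨z, ζ⟩
    have h1 : Complex.I * (Complex.I / 2) = -2⁻¹ := by
      rw [← mul_div_assoc, Complex.I_mul_I]; norm_num
    simp only [hw, ha, hc, hC, Prod.smul_mk, Prod.mk_add_mk, conjCLM_smul, map_add, map_sub,
      conjCLM_conjCLM, map_neg, map_div₀, Complex.conj_I, smul_smul, mul_neg, h1, map_inv₀,
      Complex.conj_ofNat, neg_div, neg_neg]
    refine Prod.ext ?_ ?_ <;> simp only <;> module
  have hev : ∀ᶠ q in 𝓝 (0 : E × E), AnalyticAt ℂ D q := hD.eventually_analyticAt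
  have hball : ∀ᶠ p in 𝓝 (0 : E × E), ∀ t ∈ Metric.closedBall (0 : ℂ) 2, AnalyticAt ℂ D (w p t) := by
    refine (isCompact_closedBall (0 : ℂ) 2).eventually_forall_of_forall_eventually fun t _ ↦ ?_
    have : Tendsto (fun q : (E × E) × ℂ ↦ w q.1 q.2) (𝓝 (0, t)) (𝓝 0) := by
      have := hwc.tendsto (0, t)
      rwa [hw0] at this
    exact this.eventually hev
  have hrealball : ∀ᶠ p in 𝓝 (0 : E × E), ∀ t ∈ Metric.closedBall (0 : ℝ) 1,
      D (a p + t • c p, C (a p + t • c p)) = 0 := by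
    refine (isCompact_closedBall (0 : ℝ) 1).eventually_forall_of_forall_eventually fun t _ ↦ ?_
    have hcont : Continuous fun q : (E × E) × ℝ ↦ a q.1 + q.2 • c q.1 := by
      have : Continuous fun q : (E × E) × ℝ ↦ a q.1 + (q.2 : ℂ) • c q.1 := by fun_prop
      simpa only [coe_real_smul] using this
    have : Tendsto (fun q : (E × E) × ℝ ↦ a q.1 + q.2 • c q.1) (𝓝 (0, t)) (𝓝 0) := by
      have h := hcont.tendsto (0, t)
      simpa [ha, hc] using h
    exact this.eventually h0
  filter_upwards [hball, hrealball] with p hp hp'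
  have hline : AnalyticOnNhd ℂ (fun t ↦ D (w p t)) (Metric.ball (0 : ℂ) 2) := fun t ht ↦ by
    refine AnalyticAt.fun_comp (hp t (Metric.ball_subset_closedBall ht)) ?_
    exact analyticAt_const.add (analyticAt_id.smul analyticAt_const)
  have hfreq : ∃ᶠ t in 𝓝[≠] (0 : ℂ), D (w p t) = 0 := by
    have hu : Tendsto (fun n : ℕ ↦ ((1 / ((n : ℝ) + 1) : ℝ) : ℂ)) atTop (𝓝[≠] 0) := by
      refine tendsto_nhdsWithin_iff.2 ⟨?_, Eventually.of_forall fun n ↦ ?_⟩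
      · have := (Complex.continuous_ofReal.tendsto 0).comp
          (tendsto_one_div_add_atTop_nhds_zero_nat (𝕜 := ℝ))
        exact this
      · have : (1 / ((n : ℝ) + 1) : ℝ) ≠ 0 := by positivity
        exact Complex.ofReal_ne_zero.2 this
    refine hu.frequently (Frequently.of_forall fun n ↦ ?_)
    rw [hreal]
    refine hp' _ ?_
    rw [mem_closedBall_zero_iff, Real.norm_of_nonneg (by positivity)]
    exact (div_le_one (by positivity)).2 (by linarith [n.cast_nonneg (α := ℝ)])
  have := hline.eqOn_zero_of_preconnected_of_frequently_eq_zero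
    (convex_ball (0 : ℂ) 2).isPreconnected (Metric.mem_ball_self two_pos) hfreq
    (show Complex.I ∈ Metric.ball (0 : ℂ) 2 by simp)
  simpa [hI] using this

end Conjugation

/-! ### Holomorphic primitives in the second variable. -/

section HolomorphicPrimitive

open Filter MeasureTheory

variable {E : Type*} [NormedAddCommGroup E] [NormedSpace ℂ E]
  {F : Type*} [NormedAddCommGroup F] [NormedSpace ℂ F]

variable (E) in
/-- The linear map `(z, ζ) ↦ (z, t ζ)`. -/
def scaleSnd (t : ℂ) : E × E →L[ℂ] E × E :=
  (ContinuousLinearMap.fst ℂ E E).prod (t • ContinuousLinearMap.snd ℂ E E)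

theorem scaleSnd_apply (t : ℂ) (p : E × E) : scaleSnd E t p = (p.1, t • p.2) := rfl

theorem norm_scaleSnd_apply_le {t : ℂ} (ht : ‖t‖ ≤ 1) (p : E × E) : ‖scaleSnd E t p‖ ≤ ‖p‖ := by
  rw [scaleSnd_apply, Prod.norm_def, Prod.norm_def, norm_smul]
  exact max_le_max le_rfl (mul_le_of_le_one_left (norm_nonneg _) ht)

theorem norm_scaleSnd_le {t : ℂ} (ht : ‖t‖ ≤ 1) : ‖scaleSnd E t‖ ≤ 1 :=
  ContinuousLinearMap.opNorm_le_bound _ zero_le_one fun p ↦ by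
    simpa using norm_scaleSnd_apply_le ht p

theorem continuous_scaleSnd : Continuous (scaleSnd E) := by
  have : scaleSnd E = fun t ↦
      ((ContinuousLinearMap.inl ℂ E E).comp (ContinuousLinearMap.fst ℂ E E)) +
        t • ((ContinuousLinearMap.inr ℂ E E).comp (ContinuousLinearMap.snd ℂ E E)) := by
    ext t p <;> simp [scaleSnd]
  rw [this]
  fun_prop

variable [CompleteSpace F]

/-- A family of holomorphic `1`-forms `G (z, ζ) dζ` that is closed with respect to `ζ` has a
holomorphic primitive with respect to `ζ`. -/
theorem exists_primitive_snd [FiniteDimensional ℂ E] {G : E × E → E →L[ℂ] F} (hG : AnalyticAt ℂ G 0)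
    (hsymm : ∀ᶠ p in 𝓝 (0 : E × E), ∀ u v, fderiv ℂ G p (0, u) v = fderiv ℂ G p (0, v) u) :
    ∃ H : E × E → F, AnalyticAt ℂ H 0 ∧
      ∀ᶠ p in 𝓝 (0 : E × E), ∀ v, fderiv ℂ H p (0, v) = G p v := by
  set M := ‖G 0‖ + ‖fderiv ℂ G 0‖ + 1 with hM
  have hM0 : 0 ≤ M := by positivity
  have hbG : ∀ᶠ p in 𝓝 (0 : E × E), ‖G p‖ < M :=
    hG.continuousAt.norm.eventually_lt_const (by rw [hM]; linarith [norm_nonneg (fderiv ℂ G 0)])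
  have hbD : ∀ᶠ p in 𝓝 (0 : E × E), ‖fderiv ℂ G p‖ < M :=
    hG.fderiv.continuousAt.norm.eventually_lt_const (by rw [hM]; linarith [norm_nonneg (G 0)])
  obtain ⟨r, hr, hball⟩ := Metric.eventually_nhds_iff_ball.1
    (((hG.eventually_analyticAt.and hsymm).and hbG).and hbD)
  -- Poincaré's homotopy formula in `ζ`: the primitive is `∫₀¹ G (z, t ζ) ζ dt`. Differentiation
  -- under the integral gives complex differentiability in `(z, ζ)`, hence analyticity by Osgood's
  -- lemma.
  set Φ : E × E → ℝ → F := fun p t ↦ G (scaleSnd E t p) p.2 with hΦ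
  set Φ' : E × E → ℝ → (E × E →L[ℂ] F) := fun p t ↦
    (G (scaleSnd E t p)).comp (.snd ℂ E E) +
      ((fderiv ℂ G (scaleSnd E t p)).comp (scaleSnd E t)).flip p.2 with hΦ'
  have hnorm : ∀ t ∈ Icc (0 : ℝ) 1, ‖(t : ℂ)‖ ≤ 1 := fun t ht ↦ by
    rw [Complex.norm_real, Real.norm_of_nonneg ht.1]
    exact ht.2
  have hmem : ∀ p ∈ Metric.ball (0 : E × E) r, ∀ t ∈ Icc (0 : ℝ) 1,
      scaleSnd E t p ∈ Metric.ball 0 r := fun p hp t ht ↦ by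
    rw [mem_ball_zero_iff] at hp ⊢
    exact (norm_scaleSnd_apply_le (hnorm t ht) p).trans_lt hp
  have hd : ∀ p ∈ Metric.ball (0 : E × E) r, ∀ t ∈ Icc (0 : ℝ) 1,
      HasFDerivAt (fun p ↦ Φ p t) (Φ' p t) p := fun p hp t ht ↦ by
    have h1 := ((hball _ (hmem p hp t ht)).1.1.1.differentiableAt.hasFDerivAt).comp p
      (scaleSnd E t).hasFDerivAt
    exact h1.clm_apply hasFDerivAt_snd
  have hcS : ∀ p, Continuous fun t : ℝ ↦ scaleSnd E t p := fun p ↦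
    (continuous_scaleSnd.comp Complex.continuous_ofReal).clm_apply continuous_const
  have hcG : ∀ p ∈ Metric.ball (0 : E × E) r,
      ContinuousOn (fun t : ℝ ↦ G (scaleSnd E t p)) (Icc 0 1) := fun p hp t ht ↦
    (ContinuousAt.comp (f := fun t : ℝ ↦ scaleSnd E t p)
      (hball _ (hmem p hp t ht)).1.1.1.continuousAt (hcS p).continuousAt).continuousWithinAt
  have hcD : ∀ p ∈ Metric.ball (0 : E × E) r,
      ContinuousOn (fun t : ℝ ↦ fderiv ℂ G (scaleSnd E t p)) (Icc 0 1) := fun p hp t ht ↦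
    (ContinuousAt.comp (f := fun t : ℝ ↦ scaleSnd E t p)
      (hball _ (hmem p hp t ht)).1.1.1.fderiv.continuousAt (hcS p).continuousAt).continuousWithinAt
  have hcΦ : ∀ p ∈ Metric.ball (0 : E × E) r, ContinuousOn (Φ p) (Icc 0 1) := fun p hp ↦
    (hcG p hp).clm_apply continuousOn_const
  have hcΦ' : ∀ p ∈ Metric.ball (0 : E × E) r, ContinuousOn (Φ' p) (Icc 0 1) := fun p hp ↦ by
    refine ((hcG p hp).clm_comp continuousOn_const).add ?_
    have h1 : ContinuousOn (fun t : ℝ ↦ (fderiv ℂ G (scaleSnd E t p)).comp (scaleSnd E t))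
      (Icc 0 1) := (hcD p hp).clm_comp
        (continuous_scaleSnd.comp Complex.continuous_ofReal).continuousOn
    have h2 : Continuous fun A : E × E →L[ℂ] E →L[ℂ] F ↦ A.flip p.2 :=
      ((ContinuousLinearMap.flipₗᵢ ℂ (E × E) E F).continuous).clm_apply continuous_const
    exact h2.comp_continuousOn h1
  have hIoc : uIoc (0 : ℝ) 1 ⊆ Icc 0 1 := by
    rw [uIoc_of_le zero_le_one]
    exact Ioc_subset_Icc_self
  have hder : ∀ p ∈ Metric.ball (0 : E × E) r,
      HasFDerivAt (fun p ↦ ∫ t in (0 : ℝ)..1, Φ p t) (∫ t in (0 : ℝ)..1, Φ' p t) p := fun p hp ↦ by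
    refine intervalIntegral.hasFDerivAt_integral_of_dominated_of_fderiv_le
      (bound := fun _ ↦ M + M * r) (Metric.isOpen_ball.mem_nhds hp) ?_ ?_ ?_ ?_
      intervalIntegrable_const ?_
    · filter_upwards [Metric.isOpen_ball.mem_nhds hp] with q hq
      exact ((hcΦ q hq).mono hIoc).aestronglyMeasurable measurableSet_uIoc
    · exact (hcΦ p hp).intervalIntegrable_of_Icc zero_le_one
    · exact ((hcΦ' p hp).mono hIoc).aestronglyMeasurable measurableSet_uIoc
    · refine Eventually.of_forall fun t ht q hq ↦ ?_
      have hq' := hball _ (hmem q hq t (hIoc ht))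
      refine norm_add_le_of_le ?_ ?_
      · refine (ContinuousLinearMap.opNorm_comp_le _ _).trans ?_
        refine (mul_le_mul hq'.1.2.le (ContinuousLinearMap.norm_snd_le ℂ E E) (norm_nonneg _)
          hM0).trans_eq (mul_one M)
      · refine (ContinuousLinearMap.le_opNorm _ _).trans ?_
        rw [ContinuousLinearMap.opNorm_flip]
        refine mul_le_mul ?_ ?_ (norm_nonneg _) hM0
        · refine (ContinuousLinearMap.opNorm_comp_le _ _).trans ?_
          exact (mul_le_mul hq'.2.le (norm_scaleSnd_le (hnorm t (hIoc ht))) (norm_nonneg _)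
            hM0).trans_eq (mul_one M)
        · exact (norm_snd_le q).trans (mem_ball_zero_iff.1 hq).le
    · exact Eventually.of_forall fun t ht q hq ↦ hd q hq t (hIoc ht)
  refine ⟨fun p ↦ ∫ t in (0 : ℝ)..1, Φ p t, ?_, ?_⟩
  · exact analyticOnNhd_of_differentiableOn Metric.isOpen_ball
      (fun p hp ↦ (hder p hp).differentiableAt.differentiableWithinAt) 0 (Metric.mem_ball_self hr)
  · filter_upwards [Metric.ball_mem_nhds 0 hr] with p hp v
    rw [(hder p hp).fderiv, ContinuousLinearMap.intervalIntegral_apply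
      ((hcΦ' p hp).intervalIntegrable_of_Icc zero_le_one)]
    -- The symmetry of the `ζ`-derivative turns the differentiated integrand into the exact
    -- `t`-derivative of `t G (z, t ζ) v`.
    have hFTC : ∀ t ∈ uIcc (0 : ℝ) 1,
        HasDerivAt (fun t : ℝ ↦ (t : ℂ) • G (scaleSnd E t p) v) (Φ' p t (0, v)) t := by
      intro t ht
      rw [uIcc_of_le zero_le_one] at ht
      have hq := hball _ (hmem p hp t ht)
      have h1 : HasDerivAt (fun t : ℝ ↦ scaleSnd E t p) (0, p.2) t := by
        have h : HasDerivAt (fun t : ℝ ↦ (p.1, (t : ℂ) • p.2)) (0, (1 : ℂ) • p.2) t :=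
          (hasDerivAt_const t p.1).prodMk (Complex.ofRealCLM.hasDerivAt.smul_const p.2)
        rwa [one_smul] at h
      have h2 : HasDerivAt (fun t : ℝ ↦ G (scaleSnd E t p))
          (fderiv ℂ G (scaleSnd E t p) (0, p.2)) t :=
        (hq.1.1.1.differentiableAt.hasFDerivAt.restrictScalars ℝ).comp_hasDerivAt
          (f := fun t : ℝ ↦ scaleSnd E t p) t h1
      have h3 : HasDerivAt (fun t : ℝ ↦ G (scaleSnd E t p) v)
          (fderiv ℂ G (scaleSnd E t p) (0, p.2) v) t :=
        ((ContinuousLinearMap.apply ℂ F v).restrictScalars ℝ).hasFDerivAt.comp_hasDerivAt t h2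
      have h4 : HasDerivAt (fun t : ℝ ↦ (t : ℂ)) 1 t := Complex.ofRealCLM.hasDerivAt
      refine (h4.smul h3).congr_deriv ?_
      rw [hq.1.1.2 p.2 v]
      simp only [hΦ', scaleSnd_apply, _root_.add_apply, ContinuousLinearMap.comp_apply,
        ContinuousLinearMap.flip_apply, ContinuousLinearMap.coe_snd', one_smul]
      rw [add_comm]
      have : ((0 : E), (t : ℂ) • v) = (t : ℂ) • ((0 : E), v) := by simp
      rw [this, map_smul]
      rfl
    rw [intervalIntegral.integral_eq_sub_of_hasDerivAt hFTC]
    · simp [scaleSnd_apply]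
    · exact ((hcΦ' p hp).clm_apply continuousOn_const).intervalIntegrable_of_Icc zero_le_one

end HolomorphicPrimitive

/-! ### Real analytic regularity for the `∂̄`-equation. -/

section AnalyticRegularity

open Filter

variable {E : Type*} [NormedAddCommGroup E] [NormedSpace ℂ E]
  {F : Type*} [NormedAddCommGroup F] [NormedSpace ℝ F] [NormedSpace ℂ F] [IsScalarTower ℝ ℂ F]

/-- The Cauchy–Riemann equations: the real derivative commutes with `i` and is therefore complex
linear. -/
theorem differentiableAt_of_dbarDeriv_eq_zero {f : E → F} {z : E} (hf : DifferentiableAt ℝ f z)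
    (h : ∀ u, dbarDeriv f z u = 0) : DifferentiableAt ℂ f z := by
  have hI : ∀ u, fderiv ℝ f z (Complex.I • u) = Complex.I • fderiv ℝ f z u := fun u ↦ by
    have h1 := (smul_eq_zero.1 (h u)).resolve_left (by norm_num)
    have h2 := congrArg (Complex.I • ·) h1
    simp only [smul_add, smul_smul, Complex.I_mul_I, neg_smul, one_smul, smul_zero] at h2
    exact (eq_of_sub_eq_zero (by rw [sub_eq_add_neg]; exact h2)).symm
  refine (differentiableAt_iff_restrictScalars ℝ hf).2
    ⟨{ fderiv ℝ f z with map_smul' := fun c u ↦ ?_ }, ?_⟩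
  · change fderiv ℝ f z (c • u) = c • fderiv ℝ f z u
    have h1 : c • u = c.re • u + c.im • (Complex.I • u) := by
      rw [← coe_real_smul, ← coe_real_smul, smul_smul, ← add_smul, Complex.re_add_im]
    have h2 : c • fderiv ℝ f z u =
        c.re • fderiv ℝ f z u + c.im • (Complex.I • fderiv ℝ f z u) := by
      rw [← coe_real_smul, ← coe_real_smul, smul_smul, ← add_smul, Complex.re_add_im]
    rw [h1, h2, map_add, map_smul, map_smul, hI]
  · ext u
    rfl

theorem analyticAt_of_dbarDeriv_eq_zero [FiniteDimensional ℂ E] [CompleteSpace F] {f : E → F}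
    {z : E} (hf : ∀ᶠ y in 𝓝 z, DifferentiableAt ℝ f y)
    (h : ∀ᶠ y in 𝓝 z, ∀ u, dbarDeriv f y u = 0) : AnalyticAt ℂ f z := by
  obtain ⟨r, hr, hb⟩ := Metric.eventually_nhds_iff_ball.1 (hf.and h)
  exact analyticOnNhd_of_differentiableOn Metric.isOpen_ball (fun y hy ↦
    (differentiableAt_of_dbarDeriv_eq_zero (hb y hy).1 (hb y hy).2).differentiableWithinAt) z
      (Metric.mem_ball_self hr)

variable [FiniteDimensional ℂ E] {ι : Type*} [Fintype ι] (b : Module.Basis ι ℂ E)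

/-- The embedding `y ↦ (y, conj y)`. -/
def graphConj : E →L[ℝ] E × E := (ContinuousLinearMap.id ℝ E).prod (conjCLM b)

theorem graphConj_apply (y : E) : graphConj b y = (y, conjCLM b y) := rfl

theorem tendsto_graphConj : Tendsto (graphConj b) (𝓝 0) (𝓝 0) := by
  simpa using (graphConj b).continuous.tendsto 0

theorem hasFDerivAt_comp_graphConj {G : E × E → F} {y : E}
    (hG : DifferentiableAt ℂ G (graphConj b y)) : HasFDerivAt (fun y ↦ G (graphConj b y))
      (((fderiv ℂ G (graphConj b y)).restrictScalars ℝ).comp (graphConj b)) y :=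
  (hG.hasFDerivAt.restrictScalars ℝ).comp y (graphConj b).hasFDerivAt

/-- In the antilinear part the `z`-derivative of `G` cancels and the `ζ`-derivative survives, so
solving `∂̄` becomes integrating in `ζ`. -/
theorem dbarDeriv_comp_graphConj {G : E × E → F} {y : E}
    (hG : DifferentiableAt ℂ G (graphConj b y)) (u : E) :
    dbarDeriv (fun y ↦ G (graphConj b y)) y u =
      fderiv ℂ G (graphConj b y) (0, conjCLM b u) := by
  rw [dbarDeriv, (hasFDerivAt_comp_graphConj b hG).fderiv]
  simp only [ContinuousLinearMap.comp_apply, ContinuousLinearMap.coe_restrictScalars', ← map_smul,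
    ← map_add]
  congr 1
  simp only [graphConj_apply, conjCLM_smul, Prod.smul_mk, Prod.mk_add_mk, smul_smul,
    Complex.I_mul_I, Complex.conj_I]
  refine Prod.ext ?_ ?_
  · simp
  · simp only [mul_neg, Complex.I_mul_I]
    module

theorem conj_smul_antilinear {A : E →L[ℝ] F} (hA : ∀ u, A (Complex.I • u) = -(Complex.I • A u))
    (v : E) : A (conjCLM b v) = ∑ j, b.repr v j • A (b j) := by
  rw [conjCLM_apply, map_sum]
  exact Finset.sum_congr rfl fun j _ ↦ by rw [antilinear_smul hA, Complex.conj_conj]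

/-- The failure of closedness of `G` in the directions of `j`, packaged as one analytic function so
that the uniqueness result `eventually_eq_zero_of_conj` applies to it. -/
theorem exists_analyticAt_fderiv_flip_sub {𝕜 A V W : Type*} [NontriviallyNormedField 𝕜]
    [NormedAddCommGroup A] [NormedSpace 𝕜 A] [NormedAddCommGroup V] [NormedSpace 𝕜 V]
    [NormedAddCommGroup W] [NormedSpace 𝕜 W] [CompleteSpace W] {G : A → V →L[𝕜] W} {p₀ : A}
    (hG : AnalyticAt 𝕜 G p₀) (j : V →L[𝕜] A) :
    ∃ D : A → V →L[𝕜] V →L[𝕜] W, AnalyticAt 𝕜 D p₀ ∧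
      ∀ p u v, D p u v = fderiv 𝕜 G p (j u) v - fderiv 𝕜 G p (j v) u := by
  let T : (A →L[𝕜] V →L[𝕜] W) →L[𝕜] (V →L[𝕜] V →L[𝕜] W) :=
    (ContinuousLinearMap.compL 𝕜 V A (V →L[𝕜] W)).flip j
  let T' := T - ((ContinuousLinearMap.flipₗᵢ 𝕜 V V W).toContinuousLinearEquiv :
    (V →L[𝕜] V →L[𝕜] W) →L[𝕜] (V →L[𝕜] V →L[𝕜] W)).comp T
  have hT' : AnalyticAt 𝕜 T' (fderiv 𝕜 G p₀) :=
    ContinuousLinearMap.analyticAt (𝕜 := 𝕜) (E := A →L[𝕜] V →L[𝕜] W) (F := V →L[𝕜] V →L[𝕜] W) T' _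
  exact ⟨fun p ↦ T' (fderiv 𝕜 G p), hT'.comp hG.fderiv, fun p u v ↦ rfl⟩

/-- Extend `g` to a holomorphic `G (z, ζ)`, integrate it in `ζ`, and restrict to `ζ = conj z`. The
result is an analytic solution of the same equation, so it differs from `f` by a holomorphic
function. -/
theorem analyticAt_zero_of_dbarDeriv_eq [CompleteSpace F] {f : E → F} {g : E → E →L[ℝ] F}
    (hf : ∀ᶠ z in 𝓝 0, ContDiffAt ℝ ∞ f z) (hg : AnalyticAt ℝ g 0)
    (h : ∀ᶠ z in 𝓝 0, ∀ u, dbarDeriv f z u = g z u) : AnalyticAt ℝ f 0 := by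
  set b := Module.finBasis ℂ E
  have hγ : ∀ j, AnalyticAt ℝ (fun y ↦ g y (b j)) 0 := fun j ↦
    ((ContinuousLinearMap.apply ℝ F (b j)).analyticAt _).comp hg
  choose Gc hGc hGceq using fun j ↦ exists_analyticAt_complexification b (hγ j)
  -- `G` must be complex linear in its vector argument while `g y` is antilinear; on the totally
  -- real subspace it therefore equals `g y` composed with conjugation.
  set G : E × E → E →L[ℂ] F := fun p ↦
    ∑ j, ContinuousLinearMap.smulRightL ℂ E F (coordCLM b j) (Gc j p) with hGdef
  have hG : AnalyticAt ℂ G 0 := Finset.analyticAt_fun_sum _ fun j _ ↦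
    ((ContinuousLinearMap.smulRightL ℂ E F (coordCLM b j)).analyticAt _).comp (hGc j)
  have hGeq : ∀ᶠ y in 𝓝 (0 : E), ∀ v, G (graphConj b y) v = g y (conjCLM b v) := by
    filter_upwards [eventually_all.2 hGceq, h] with y hy hy' v
    have hA : ∀ u, g y (Complex.I • u) = -(Complex.I • g y u) := fun u ↦ by
      rw [← hy', ← hy', dbarDeriv_I_smul]
    rw [conj_smul_antilinear b hA]
    simp [hGdef, graphConj_apply, ← hy]
  have hGd : ∀ᶠ y in 𝓝 (0 : E), DifferentiableAt ℂ G (graphConj b y) :=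
    (tendsto_graphConj b).eventually (hG.eventually_analyticAt.mono fun _ h ↦ h.differentiableAt)
  have hGder : ∀ᶠ y in 𝓝 (0 : E), ∀ u v, fderiv ℂ G (graphConj b y) (0, u) v =
      dbarDeriv (fun y ↦ dbarDeriv f y (conjCLM b v)) y (conjCLM b u) := by
    filter_upwards [hGd, hGeq.eventually_nhds, h.eventually_nhds] with y hd he hh u v
    have h1 : (fun y ↦ dbarDeriv f y (conjCLM b v)) =ᶠ[𝓝 y] fun y ↦ G (graphConj b y) v := by
      filter_upwards [he, hh] with z hz hz'
      rw [hz, hz']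
    rw [dbarDeriv_congr h1]
    have hd' : DifferentiableAt ℂ (fun p ↦ G p v) (graphConj b y) :=
      hd.clm_apply (differentiableAt_const v)
    rw [dbarDeriv_comp_graphConj b hd', conjCLM_conjCLM]
    have := (hd.hasFDerivAt.clm_apply (hasFDerivAt_const v _)).fderiv
    rw [this]
    simp
  obtain ⟨D, hD, hDapply⟩ := exists_analyticAt_fderiv_flip_sub hG (.inr ℂ E E)
  simp only [ContinuousLinearMap.inr_apply] at hDapply
  -- On the totally real subspace this is `∂̄² f = 0`; uniqueness of holomorphic extension carries
  -- it to a full neighbourhood.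
  have hsymm : ∀ᶠ p in 𝓝 (0 : E × E), ∀ u v, fderiv ℂ G p (0, u) v = fderiv ℂ G p (0, v) u := by
    have h2 := eventually_eq_zero_of_conj b hD (by
      filter_upwards [hGder, hf] with y hy hfy
      ext u v
      rw [hDapply]
      have := hy u v
      have h3 := hy v u
      rw [graphConj_apply] at this h3
      rw [this, h3, dbarDeriv_dbarDeriv_comm hfy]
      simp)
    filter_upwards [h2] with p hp u v
    rw [← sub_eq_zero, ← hDapply, hp]
    rfl
  obtain ⟨H, hH, hHG⟩ := exists_primitive_snd hG hsymm
  set f' : E → F := fun y ↦ H (graphConj b y) with hf'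
  have hf'an : AnalyticAt ℝ f' 0 := by
    have h1 : AnalyticAt ℝ H 0 := hH.restrictScalars
    exact AnalyticAt.comp (by simpa using h1) ((graphConj b).analyticAt 0)
  have hf'd : ∀ᶠ y in 𝓝 0, ∀ u, dbarDeriv f' y u = g y u := by
    filter_upwards [(tendsto_graphConj b).eventually
      (hH.eventually_analyticAt.mono fun _ h ↦ h.differentiableAt),
      (tendsto_graphConj b).eventually hHG, hGeq] with y hy hy' hy'' u
    rw [dbarDeriv_comp_graphConj b hy, hy', hy'', conjCLM_conjCLM]
  have hdiff : AnalyticAt ℂ (fun y ↦ f y - f' y) 0 := by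
    refine analyticAt_of_dbarDeriv_eq_zero ?_ ?_
    · filter_upwards [hf, hf'an.eventually_analyticAt] with y hy hy'
      exact (hy.differentiableAt (by simp)).sub hy'.differentiableAt
    · filter_upwards [hf, hf'an.eventually_analyticAt, h, hf'd] with y hy hy' h1 h2 u
      rw [dbarDeriv_sub (hy.differentiableAt (by simp)) hy'.differentiableAt, h1, h2, sub_self]
  have h1 : AnalyticAt ℝ (fun y ↦ f y - f' y) 0 := hdiff.restrictScalars
  have h2 : (fun y ↦ f y - f' y) + f' = f := by
    ext y
    simp
  exact h2 ▸ h1.add hf'an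

/-- Analytic regularity for the `∂̄`-equation: if `∂̄ f` is real analytic, so is `f`. -/
theorem analyticAt_of_dbarDeriv_eq [CompleteSpace F] {f : E → F} {g : E → E →L[ℝ] F} {x₀ : E}
    (hf : ∀ᶠ z in 𝓝 x₀, ContDiffAt ℝ ∞ f z) (hg : AnalyticAt ℝ g x₀)
    (h : ∀ᶠ z in 𝓝 x₀, ∀ u, dbarDeriv f z u = g z u) : AnalyticAt ℝ f x₀ := by
  have ht : Tendsto (fun y ↦ x₀ + y) (𝓝 0) (𝓝 x₀) := by
    simpa using (continuous_const_add x₀).tendsto (0 : E)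
  have ha : ∀ y, AnalyticAt ℝ (fun y : E ↦ x₀ + y) y := fun y ↦
    analyticAt_const.add analyticAt_id
  have h0 : AnalyticAt ℝ (fun y ↦ f (x₀ + y)) 0 := by
    refine analyticAt_zero_of_dbarDeriv_eq (g := fun y ↦ g (x₀ + y)) ?_ ?_ ?_
    · filter_upwards [ht.eventually hf] with y hy
      exact hy.comp y (contDiffAt_const.add contDiffAt_id)
    · exact AnalyticAt.fun_comp (g := g) (by simpa using hg) (ha 0)
    · filter_upwards [ht.eventually h] with y hy u
      rw [← hy u, dbarDeriv, dbarDeriv, fderiv_comp_add_left]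
  have h1 : AnalyticAt ℝ (fun x ↦ (fun y ↦ f (x₀ + y)) (x - x₀)) x₀ :=
    AnalyticAt.fun_comp (g := fun y ↦ f (x₀ + y)) (by simpa using h0)
      (analyticAt_id.sub analyticAt_const)
  simpa using h1

end AnalyticRegularity

/-! ### Linear algebra and closedness of real `(1,1)`-forms in a chart. -/

section LocalForms

open Filter

variable {E : Type*} [NormedAddCommGroup E] [NormedSpace ℂ E]

variable (E) in
/-- The map sending a real bilinear alternating form `η` to
`(u, v) ↦ (η (u, v) - i η (u, i v)) / 2`. -/
def antilinearPart : (E [⋀^Fin 2]→L[ℝ] ℝ) →L[ℝ] (E →L[ℝ] E →L[ℂ] ℂ) :=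
  (2⁻¹ : ℝ) •
    (ContinuousLinearMap.compL ℝ E (E [⋀^Fin 1]→L[ℝ] ℝ) (E →L[ℂ] ℂ)
      ((StrongDual.extendRCLikeₗᵢ (𝕜 := ℂ) (F := E)).toContinuousLinearEquiv.toContinuousLinearMap.comp
        (ContinuousAlternatingMap.ofSubsingletonLIE (𝕜 := ℝ) (E := E) (F := ℝ)
          (0 : Fin 1)).symm.toContinuousLinearEquiv.toContinuousLinearMap)).comp
    (ContinuousAlternatingMap.curryLeftLI (𝕜 := ℝ) (E := E) (F := ℝ) (n := 1)).toContinuousLinearMap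

theorem antilinearPart_apply (η : E [⋀^Fin 2]→L[ℝ] ℝ) (u v : E) :
    antilinearPart E η u v =
      2⁻¹ * ((η ![u, v] : ℂ) - Complex.I * (η ![u, Complex.I • v] : ℂ)) := by
  have h : ∀ w : E, (Matrix.vecCons u fun _ : Fin 1 ↦ w) = ![u, w] := fun w ↦ by
    congr
    ext i
    fin_cases i
    rfl
  have h' : ∀ w, (ContinuousAlternatingMap.ofSubsingletonLIE (𝕜 := ℝ) (E := E) (F := ℝ)
      (0 : Fin 1)).symm (η.curryLeft u) w = η ![u, w] := fun w ↦ by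
    rw [← h w]
    rfl
  change (2⁻¹ : ℝ) • (StrongDual.extendRCLike (𝕜 := ℂ) ((ContinuousAlternatingMap.ofSubsingletonLIE
    (𝕜 := ℝ) (E := E) (F := ℝ) (0 : Fin 1)).symm (η.curryLeft u)) v : ℂ) = _
  rw [StrongDual.extendRCLike_apply, h', h']
  simp

theorem alternating_swap (η : E [⋀^Fin 2]→L[ℝ] ℝ) (u v : E) : η ![v, u] = -η ![u, v] := by
  have := η.map_swap ![u, v] (show (0 : Fin 2) ≠ 1 by decide)
  refine Eq.trans ?_ this
  change η _ = η _
  congr 1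
  ext i
  fin_cases i <;> rfl

theorem alternating_neg_right (η : E [⋀^Fin 2]→L[ℝ] ℝ) (u v : E) : η ![u, -v] = -η ![u, v] := by
  have h : ∀ w, Function.update ![u, v] 1 w = ![u, w] := fun w ↦ by
    ext i
    fin_cases i <;> rfl
  have := η.map_update_smul ![u, v] 1 (-1) v
  rw [h, h] at this
  simpa using this

theorem alternating_I_left {η : E [⋀^Fin 2]→L[ℝ] ℝ}
    (hη : ∀ u v, η ![Complex.I • u, Complex.I • v] = η ![u, v]) (u v : E) :
    η ![Complex.I • u, v] = -η ![u, Complex.I • v] := by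
  rw [← hη u, smul_smul, Complex.I_mul_I, neg_one_smul, alternating_neg_right, neg_neg]

theorem antilinearPart_I_smul {η : E [⋀^Fin 2]→L[ℝ] ℝ}
    (hη : ∀ u v, η ![Complex.I • u, Complex.I • v] = η ![u, v]) (u : E) :
    antilinearPart E η (Complex.I • u) = -(Complex.I • antilinearPart E η u) := by
  ext v
  rw [antilinearPart_apply, hη, alternating_I_left hη]
  simp only [neg_apply, smul_apply, antilinearPart_apply, smul_eq_mul]
  push_cast
  linear_combination -(2⁻¹ * (η ![u, Complex.I • v] : ℂ)) * Complex.I_sq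

theorem extDeriv_two_apply {η : E → E [⋀^Fin 2]→L[ℝ] ℝ} {z : E} (hη : DifferentiableAt ℝ η z)
    (a b c : E) : extDeriv η z ![a, b, c] =
      fderiv ℝ η z a ![b, c] - fderiv ℝ η z b ![a, c] + fderiv ℝ η z c ![a, b] := by
  have h : ∀ (w : Fin 2 → E) (u : E), fderiv ℝ (fun y ↦ η y w) z u = fderiv ℝ η z u w :=
    fun w u ↦ by
      rw [fderiv_continuousAlternatingMap_apply_const_apply hη]
  have h0 : (0 : Fin 3).removeNth ![a, b, c] = ![b, c] := by
    ext i; fin_cases i <;> rfl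
  have h1 : (1 : Fin 3).removeNth ![a, b, c] = ![a, c] := by
    ext i; fin_cases i <;> rfl
  have h2 : (2 : Fin 3).removeNth ![a, b, c] = ![a, b] := by
    ext i; fin_cases i <;> rfl
  rw [extDeriv_apply hη, Fin.sum_univ_three]
  simp only [h, h0, h1, h2]
  simp
  ring

/-- The derivative of `η` is again `J`-invariant. The identity is then a combination of `dη = 0` on
the four triples `(u, v, w)`, `(iu, iv, w)`, `(u, v, iw)` and `(iu, iv, iw)`. -/
theorem dbarDeriv_antilinearPart_comm {η : E → E [⋀^Fin 2]→L[ℝ] ℝ} {z : E}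
    (hη : DifferentiableAt ℝ η z) (hclosed : extDeriv η z = 0)
    (hJ : ∀ᶠ y in 𝓝 z, ∀ u v, η y ![Complex.I • u, Complex.I • v] = η y ![u, v]) (u v : E) :
    dbarDeriv (fun y ↦ antilinearPart E (η y) v) z u =
      dbarDeriv (fun y ↦ antilinearPart E (η y) u) z v := by
  have hd : ∀ v u, fderiv ℝ (fun y ↦ antilinearPart E (η y) v) z u =
      antilinearPart E (fderiv ℝ η z u) v := fun v u ↦ by
    have h1 : HasFDerivAt (fun y ↦ antilinearPart E (η y) v)
        (((antilinearPart E).flip v).comp (fderiv ℝ η z)) z :=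
      ((antilinearPart E).flip v).hasFDerivAt.comp z hη.hasFDerivAt
    rw [h1.fderiv]
    rfl
  have hDJ : ∀ a u v, fderiv ℝ η z a ![Complex.I • u, Complex.I • v] =
      fderiv ℝ η z a ![u, v] := fun a u v ↦ by
    rw [← fderiv_continuousAlternatingMap_apply_const_apply hη,
      ← fderiv_continuousAlternatingMap_apply_const_apply hη]
    have : (fun y ↦ η y ![Complex.I • u, Complex.I • v]) =ᶠ[𝓝 z] fun y ↦ η y ![u, v] :=
      hJ.mono fun y hy ↦ hy u v
    rw [this.fderiv_eq]
  have hcyc : ∀ a b c, (fderiv ℝ η z a ![b, c] : ℂ) - fderiv ℝ η z b ![a, c] +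
      fderiv ℝ η z c ![a, b] = 0 := fun a b c ↦ by
    have := extDeriv_two_apply hη a b c
    rw [hclosed] at this
    exact_mod_cast this.symm
  ext w
  simp only [dbarDeriv, hd, smul_apply, add_apply, antilinearPart_apply, smul_eq_mul]
  have e1 : ∀ a b c, fderiv ℝ η z a ![b, Complex.I • c] = -fderiv ℝ η z a ![Complex.I • b, c] :=
    fun a b c ↦ by rw [alternating_I_left (hDJ a), neg_neg]
  have c1 := hcyc u v w
  have c2 := hcyc (Complex.I • u) (Complex.I • v) w
  have c3 := hcyc u v (Complex.I • w)
  have c4 := hcyc (Complex.I • u) (Complex.I • v) (Complex.I • w)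
  rw [hDJ] at c2
  rw [hDJ, hDJ, hDJ] at c4
  rw [e1 (Complex.I • u) v w, e1 (Complex.I • v) u w]
  push_cast
  linear_combination (1 / 4 : ℂ) * c1 - (1 / 4 : ℂ) * c2 + Complex.I * (1 / 4) * (c4 - c3) +
    (1 / 4) * ((fderiv ℝ η z (Complex.I • u) ![Complex.I • v, w] : ℂ) -
      fderiv ℝ η z (Complex.I • v) ![Complex.I • u, w]) * Complex.I_sq

/-- Put `A(u, v) = dbarDeriv f z u v`, antilinear in `u` and linear in `v`. The equation at `(u, v)`
gives `A(u, v) - A(v, u)`, and at `(u, i v)` it gives `i (A(u, v) + A(v, u))`; together they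
determine `A`. Thus a scalar `(1,1)`-equation becomes a `∂̄`-equation for a covector-valued
function. -/
theorem dbar_eq_iff {f : E → E →L[ℂ] ℂ} {z : E} {η : E [⋀^Fin 2]→L[ℝ] ℝ}
    (hη : ∀ u v, η ![Complex.I • u, Complex.I • v] = η ![u, v]) :
    (∀ u v, dbar f z u v = (η ![u, v] : ℂ)) ↔ ∀ u, dbarDeriv f z u = antilinearPart E η u := by
  change (∀ u v, dbarDeriv f z u v - dbarDeriv f z v u = (η ![u, v] : ℂ)) ↔ _
  constructor
  · intro h u
    ext v
    have h1 := h u v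
    have h2 := h u (Complex.I • v)
    rw [dbarDeriv_I_smul, map_smul] at h2
    simp only [neg_apply, smul_apply, smul_eq_mul] at h2
    rw [antilinearPart_apply]
    linear_combination (1 / 2 : ℂ) * h1 - Complex.I / 2 * h2 +
      (1 / 2) * (dbarDeriv f z u v + dbarDeriv f z v u) * Complex.I_sq
  · intro h u v
    rw [h, h, antilinearPart_apply, antilinearPart_apply, alternating_swap η u v,
      alternating_swap η (Complex.I • u) v, alternating_I_left hη]
    push_cast
    ring

end LocalForms

/-! ### Local `∂̄`-primitives on the manifold and their change of charts. -/

section LocalPrimitives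

open Filter

variable {E : Type*} [NormedAddCommGroup E] [NormedSpace ℂ E]

section Bilinear

variable {A B C : Type*} [NormedAddCommGroup A] [NormedSpace ℝ A] [NormedSpace ℂ A]
  [IsScalarTower ℝ ℂ A] [NormedAddCommGroup B] [NormedSpace ℝ B] [NormedSpace ℂ B]
  [IsScalarTower ℝ ℂ B] [NormedAddCommGroup C] [NormedSpace ℝ C] [NormedSpace ℂ C]
  [IsScalarTower ℝ ℂ C] {β : A × B → C} {a : E → A} {b : E → B} {z : E}

theorem _root_.IsBoundedBilinearMap.contDiffAt_restrictScalars (hβ : IsBoundedBilinearMap ℂ β)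
    {n : ℕ∞ω} (ha : ContDiffAt ℝ n a z) (hb : ContDiffAt ℝ n b z) :
    ContDiffAt ℝ n (fun y ↦ β (a y, b y)) z :=
  ((hβ.contDiff (n := n)).restrict_scalars ℝ).contDiffAt.comp z (ha.prodMk hb)

theorem _root_.IsBoundedBilinearMap.fderiv_restrictScalars_apply (hβ : IsBoundedBilinearMap ℂ β)
    {a' : E →L[ℝ] A} {b' : E →L[ℝ] B} (ha : HasFDerivAt a a' z) (hb : HasFDerivAt b b' z) (u : E) :
    fderiv ℝ (fun y ↦ β (a y, b y)) z u = β (a z, b' u) + β (a' u, b z) := by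
  have h := (((hβ.hasFDerivAt (a z, b z)).restrictScalars ℝ).comp z (ha.prodMk hb)).fderiv
  exact congrArg (fun L ↦ L u) h

end Bilinear

theorem isBoundedBilinearMap_comp_dual :
    IsBoundedBilinearMap ℂ fun p : (E →L[ℂ] ℂ) × (E →L[ℂ] E) ↦ p.1.comp p.2 :=
  isBoundedBilinearMap_comp

theorem contDiffAt_comp_fderiv {f : E → E →L[ℂ] ℂ} {T : E → E} {z : E} {n : ℕ∞ω}
    (hT : ContDiffAt ℂ ω T z) (hf : ContDiffAt ℝ n f (T z)) :
    ContDiffAt ℝ n (fun y ↦ (f (T y)).comp (fderiv ℂ T y)) z := by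
  have h2 : ContDiffAt ℝ n (fun y ↦ f (T y)) z :=
    hf.comp z ((hT.of_le le_top).restrict_scalars ℝ)
  have h3 : ContDiffAt ℝ n (fderiv ℂ T) z :=
    ((hT.fderiv_right (m := ω) le_top).of_le le_top).restrict_scalars ℝ
  exact isBoundedBilinearMap_comp_dual.contDiffAt_restrictScalars h2 h3

/-- `∂̄` commutes with holomorphic pullback: the term containing the second derivative of `T` is
complex linear in `u`, so it drops out of the antilinear part. -/
theorem dbarDeriv_comp_fderiv {f : E → E →L[ℂ] ℂ} {T : E → E} {z : E}
    (hT : ContDiffAt ℂ ω T z) (hf : DifferentiableAt ℝ f (T z)) (u : E) :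
    dbarDeriv (fun y ↦ (f (T y)).comp (fderiv ℂ T y)) z u =
      (dbarDeriv f (T z) (fderiv ℂ T z u)).comp (fderiv ℂ T z) := by
  have h2 : HasFDerivAt (fun y ↦ f (T y))
      ((fderiv ℝ f (T z)).comp ((fderiv ℂ T z).restrictScalars ℝ)) z :=
    hf.hasFDerivAt.comp z ((hT.differentiableAt (by simp)).hasFDerivAt.restrictScalars ℝ)
  have h3 : HasFDerivAt (fderiv ℂ T) ((fderiv ℂ (fderiv ℂ T) z).restrictScalars ℝ) z :=
    ((hT.fderiv_right (m := ω) le_top).differentiableAt (by simp)).hasFDerivAt.restrictScalars ℝ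
  have h5 : ∀ u, fderiv ℝ (fun y ↦ (f (T y)).comp (fderiv ℂ T y)) z u =
      (f (T z)).comp (fderiv ℂ (fderiv ℂ T) z u) +
        (fderiv ℝ f (T z) (fderiv ℂ T z u)).comp (fderiv ℂ T z) := fun u ↦
    isBoundedBilinearMap_comp_dual.fderiv_restrictScalars_apply h2 h3 u
  ext v
  simp only [dbarDeriv, h5, map_smul]
  simp only [ContinuousLinearMap.comp_apply, add_apply, smul_apply, map_smul, smul_eq_mul]
  linear_combination (1 / 2) * (f (T z) (fderiv ℂ (fderiv ℂ T) z u v)) * Complex.I_sq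

variable {X : Type*} [TopologicalSpace X] [ChartedSpace E X]

theorem RealTwoForm.inChart_apply (κ : RealTwoForm E X) (e : OpenPartialHomeomorph X E)
    (z u v : E) : κ.inChart e z ![u, v] =
      κ (e.symm z) ![chartSymmDeriv e z u, chartSymmDeriv e z v] := by
  rw [RealTwoForm.inChart, ContinuousAlternatingMap.compContinuousLinearMap_apply]
  congr 1
  ext i
  fin_cases i <;> rfl

theorem IsKahlerForm.inChart_I_smul {κ : RealTwoForm E X} (hκ : IsKahlerForm κ)
    (e : OpenPartialHomeomorph X E) (z u v : E) :
    κ.inChart e z ![Complex.I • u, Complex.I • v] = κ.inChart e z ![u, v] := by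
  rw [RealTwoForm.inChart_apply, RealTwoForm.inChart_apply, map_smul, map_smul, hκ.typeOneOne]

set_option synthInstance.maxHeartbeats 200000 in
theorem contDiff_antilinearPart {n : ℕ∞ω} : ContDiff ℝ n (antilinearPart E) :=
  ContinuousLinearMap.contDiff (𝕜 := ℝ) (E := E [⋀^Fin 2]→L[ℝ] ℝ) (F := E →L[ℝ] E →L[ℂ] ℂ)
    (antilinearPart E)

theorem antilinearPart_zero (u : E) : antilinearPart E 0 u = 0 := by
  ext v
  exact (antilinearPart_apply 0 u v).trans (by simp)

theorem IsKahlerForm.exists_local_primitive [FiniteDimensional ℂ E] {κ : RealTwoForm E X}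
    (hκ : IsKahlerForm κ) {e : OpenPartialHomeomorph X E} (he : e ∈ atlas E X) {x : X}
    (hx : x ∈ e.source) : ∃ f : E → E →L[ℂ] ℂ, ∀ᶠ z in 𝓝 (e x), ContDiffAt ℝ ∞ f z ∧
      ∀ u v, dbar f z u v = (κ.inChart e z ![u, v] : ℂ) := by
  have hmem : ∀ᶠ z in 𝓝 (e x), z ∈ e.target := e.open_target.mem_nhds (e.map_source hx)
  have hs : ∀ z ∈ e.target, ContDiffAt ℝ ∞ (κ.inChart e) z := fun z hz ↦
    (hκ.smooth e he).contDiffAt (e.open_target.mem_nhds hz)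
  obtain ⟨f, hf, hfd⟩ := exists_dbarDeriv_eq_of_closed (x₀ := e x)
    (g := fun z ↦ antilinearPart E (κ.inChart e z))
    (hmem.mono fun z hz ↦ contDiff_antilinearPart.contDiffAt.comp z (hs z hz))
    (Eventually.of_forall fun z u ↦ antilinearPart_I_smul (hκ.inChart_I_smul e z) u)
    (hmem.mono fun z hz u v ↦ dbarDeriv_antilinearPart_comm
      ((hs z hz).differentiableAt (by simp)) (hκ.closed e he z hz)
      (Eventually.of_forall fun y ↦ hκ.inChart_I_smul e y) u v)
  refine ⟨f, hf.and (hfd.mono fun z hz ↦ ?_)⟩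
  exact (dbar_eq_iff (hκ.inChart_I_smul e z)).2 hz

variable [IsManifold 𝓘(ℂ, E) ω X]

theorem contDiffAt_transition {e e' : OpenPartialHomeomorph X E} (he : e ∈ atlas E X)
    (he' : e' ∈ atlas E X) {z : E} (hz : z ∈ e'.target) (hz' : e'.symm z ∈ e.source) :
    ContDiffAt ℂ ω (e ∘ e'.symm) z :=
  (contDiffOn_transition he he').contDiffAt
    ((e'.symm ≫ₕ e).open_source.mem_nhds (by simp [hz, hz']))

theorem RealTwoForm.inChart_comp (κ : RealTwoForm E X) {e e' : OpenPartialHomeomorph X E}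
    (he : e ∈ atlas E X) (he' : e' ∈ atlas E X) {z : E} (hz : z ∈ e'.target)
    (hz' : e'.symm z ∈ e.source) (u v : E) :
    κ.inChart e (e (e'.symm z)) ![fderiv ℂ (e ∘ e'.symm) z u, fderiv ℂ (e ∘ e'.symm) z v] =
      κ.inChart e' z ![u, v] := by
  have hT := (contDiffAt_transition he he' hz hz').differentiableAt (by simp)
  have hev : e'.symm =ᶠ[𝓝 z] e.symm ∘ (e ∘ e'.symm) := by
    filter_upwards [(e'.symm ≫ₕ e).open_source.mem_nhds
      (show z ∈ (e'.symm ≫ₕ e).source by simp [hz, hz'])] with w hw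
    simp only [OpenPartialHomeomorph.trans_source, OpenPartialHomeomorph.symm_source, mem_inter_iff,
      mem_preimage] at hw
    simp [hw.2]
  have hd : MDifferentiableAt 𝓘(ℂ, E) 𝓘(ℂ, E) e.symm ((e ∘ e'.symm) z) :=
    mdifferentiableAt_symm he (e.map_source hz')
  have h1 := ((hd.hasMFDerivAt.comp z hT.hasFDerivAt.hasMFDerivAt).congr_of_eventuallyEq hev).mfderiv
  have h2 : ((mfderiv 𝓘(ℂ, E) 𝓘(ℂ, E) e.symm (e (e'.symm z)) : E →L[ℂ] E).comp
      (fderiv ℂ (e ∘ e'.symm) z)) = mfderiv 𝓘(ℂ, E) 𝓘(ℂ, E) e'.symm z := h1.symm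
  have aux : ∀ (y w : X) (_ : y = w) (A B C : E →L[ℂ] E), A.comp B = C →
      (κ y : E [⋀^Fin 2]→L[ℝ] ℝ) ![A (B u), A (B v)] =
        (κ w : E [⋀^Fin 2]→L[ℝ] ℝ) ![C u, C v] := by
    rintro _ _ rfl _ _ _ rfl
    rfl
  rw [RealTwoForm.inChart_apply, RealTwoForm.inChart_apply]
  exact aux _ _ (e.left_inv hz') _ _ _ h2

/-- The `(1,0)`-form whose expression in the chart `e` is `f`. -/
def OneZeroForm.ofChart (e : OpenPartialHomeomorph X E) (f : E → E →L[ℂ] ℂ) : OneZeroForm E X :=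
  fun x ↦ (f (e x)).comp (mfderiv 𝓘(ℂ, E) 𝓘(ℂ, E) e x)

theorem OneZeroForm.ofChart_inChart {e e' : OpenPartialHomeomorph X E} (he : e ∈ atlas E X)
    (he' : e' ∈ atlas E X) (f : E → E →L[ℂ] ℂ) {z : E} (hz : z ∈ e'.target)
    (hz' : e'.symm z ∈ e.source) : (OneZeroForm.ofChart e f).inChart e' z =
      (f ((e ∘ e'.symm) z)).comp (fderiv ℂ (e ∘ e'.symm) z) := by
  have : IsManifold 𝓘(ℂ, E) 1 X := IsManifold.of_le (n := ω) le_top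
  have h := ((mdifferentiableAt_atlas he hz').hasMFDerivAt.comp z
    (mdifferentiableAt_symm he' hz).hasMFDerivAt).mfderiv
  rw [mfderiv_eq_fderiv] at h
  rw [h]
  rfl

/-- Smoothness and the `∂̄`-equation are required in every chart of the atlas; since transitions are
holomorphic, checking them in the single chart `e` suffices. -/
theorem OneZeroForm.ofChart_spec {κ : RealTwoForm E X} {e : OpenPartialHomeomorph X E}
    (he : e ∈ atlas E X) {f : E → E →L[ℂ] ℂ} {U : Set X} (hU : IsOpen U) (hUe : U ⊆ e.source)
    (hf : ∀ x ∈ U, ContDiffAt ℝ ∞ f (e x))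
    (hfκ : ∀ x ∈ U, ∀ u v, dbar f (e x) u v = (κ.inChart e (e x) ![u, v] : ℂ)) :
    (OneZeroForm.ofChart e f).IsOfClassOn ∞ U ∧ (OneZeroForm.ofChart e f).DbarEqOn κ U := by
  have hev : ∀ e' ∈ atlas E X, ∀ z ∈ e'.target ∩ e'.symm ⁻¹' U,
      (OneZeroForm.ofChart e f).inChart e' =ᶠ[𝓝 z]
        fun y ↦ (f ((e ∘ e'.symm) y)).comp (fderiv ℂ (e ∘ e'.symm) y) := fun e' he' z hz ↦ by
    filter_upwards [(e'.isOpen_inter_preimage_symm hU).mem_nhds hz] with y hy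
    exact OneZeroForm.ofChart_inChart he he' f hy.1 (hUe hy.2)
  constructor
  · intro e' he' z hz
    exact ((contDiffAt_comp_fderiv (contDiffAt_transition he he' hz.1 (hUe hz.2))
      (hf _ hz.2)).congr_of_eventuallyEq (hev e' he' z hz)).contDiffWithinAt
  · intro e' he' z hz u v
    have hT := contDiffAt_transition he he' hz.1 (hUe hz.2)
    have hd : ∀ u, antilinearDeriv ((OneZeroForm.ofChart e f).inChart e') z u =
        (dbarDeriv f ((e ∘ e'.symm) z) (fderiv ℂ (e ∘ e'.symm) z u)).comp
          (fderiv ℂ (e ∘ e'.symm) z) := fun u ↦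
      (dbarDeriv_congr (hev e' he' z hz) u).trans
        (dbarDeriv_comp_fderiv hT ((hf _ hz.2).differentiableAt (by simp)) u)
    rw [dbar, hd, hd, ← RealTwoForm.inChart_comp κ he he' hz.1 (hUe hz.2)]
    exact hfκ _ hz.2 _ _

/-- A Kähler form is locally `∂̄`-exact. -/
theorem IsKahlerForm.exists_oneZeroForm [FiniteDimensional ℂ E] {κ : RealTwoForm E X}
    (hκ : IsKahlerForm κ) (x : X) : ∃ (U : Set X) (ρ : OneZeroForm E X), IsOpen U ∧ x ∈ U ∧
      ρ.IsOfClassOn ∞ U ∧ ρ.DbarEqOn κ U := by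
  set e := chartAt E x
  obtain ⟨f, hf⟩ := hκ.exists_local_primitive (chart_mem_atlas E x) (mem_chart_source E x)
  obtain ⟨V, hV, hVo, hxV⟩ := eventually_nhds_iff.1 hf
  have h := OneZeroForm.ofChart_spec (κ := κ) (chart_mem_atlas E x) (f := f)
    (e.isOpen_inter_preimage hVo) inter_subset_left (fun y hy ↦ (hV _ hy.2).1)
    (fun y hy ↦ (hV _ hy.2).2)
  exact ⟨_, _, e.isOpen_inter_preimage hVo, ⟨mem_chart_source E x, hxV⟩, h⟩

/-- The difference of two `∂̄`-primitives of the same form is holomorphic. -/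
theorem OneZeroForm.isHolomorphicOn_sub [FiniteDimensional ℂ E] {κ : RealTwoForm E X}
    {α β : OneZeroForm E X} {U V : Set X} (hU : IsOpen U) (hV : IsOpen V)
    (hα : α.IsOfClassOn ∞ U) (hβ : β.IsOfClassOn ∞ V) (hακ : α.DbarEqOn κ U)
    (hβκ : β.DbarEqOn κ V) : OneZeroForm.IsHolomorphicOn (fun x ↦ α x - β x) (U ∩ V) := by
  intro e he z hz
  have hfun : OneZeroForm.inChart (fun x ↦ α x - β x) e =
      fun y ↦ α.inChart e y - β.inChart e y := by
    ext1 y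
    simp only [OneZeroForm.inChart, ContinuousLinearMap.sub_comp]
  have hα' : ∀ y ∈ e.target ∩ e.symm ⁻¹' (U ∩ V), DifferentiableAt ℝ (α.inChart e) y :=
    fun y hy ↦ ((hα e he).contDiffAt ((e.isOpen_inter_preimage_symm hU).mem_nhds
      ⟨hy.1, hy.2.1⟩)).differentiableAt (by simp)
  have hβ' : ∀ y ∈ e.target ∩ e.symm ⁻¹' (U ∩ V), DifferentiableAt ℝ (β.inChart e) y :=
    fun y hy ↦ ((hβ e he).contDiffAt ((e.isOpen_inter_preimage_symm hV).mem_nhds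
      ⟨hy.1, hy.2.2⟩)).differentiableAt (by simp)
  have hnhds := (e.isOpen_inter_preimage_symm (hU.inter hV)).mem_nhds hz
  rw [hfun]
  refine (AnalyticAt.contDiffAt (𝕜 := ℂ) ?_).contDiffWithinAt
  refine analyticAt_of_dbarDeriv_eq_zero ?_ ?_
  · filter_upwards [hnhds] with y hy
    exact (hα' y hy).sub (hβ' y hy)
  · filter_upwards [hnhds] with y hy u
    -- Stated with the zero two-form, which is `J`-invariant, so that `dbar_eq_iff` yields vanishing
    -- of the full antilinear derivative and not just of its alternation.
    have h0 : ∀ u v, dbar (fun y ↦ α.inChart e y - β.inChart e y) y u v =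
        ((0 : E [⋀^Fin 2]→L[ℝ] ℝ) ![u, v] : ℂ) := fun u v ↦ by
      change dbarDeriv (fun y ↦ α.inChart e y - β.inChart e y) y u v -
        dbarDeriv (fun y ↦ α.inChart e y - β.inChart e y) y v u = _
      rw [dbarDeriv_sub (hα' y hy) (hβ' y hy), dbarDeriv_sub (hα' y hy) (hβ' y hy)]
      have h1 : dbarDeriv (α.inChart e) y u v - dbarDeriv (α.inChart e) y v u = _ :=
        hακ e he y ⟨hy.1, hy.2.1⟩ u v
      have h2 : dbarDeriv (β.inChart e) y u v - dbarDeriv (β.inChart e) y v u = _ :=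
        hβκ e he y ⟨hy.1, hy.2.2⟩ u v
      have h3 : (0 : E [⋀^Fin 2]→L[ℝ] ℝ) ![u, v] = 0 := rfl
      simp only [sub_apply, h3, Complex.ofReal_zero]
      linear_combination h1 - h2
    rw [(dbar_eq_iff (by simp)).1 h0 u, antilinearPart_zero]

end LocalPrimitives

/-! ### Underlying real manifolds of the base and of the affine bundle. -/

section RealManifolds

variable {E : Type*} [NormedAddCommGroup E] [NormedSpace ℂ E]
  {X : Type*} [TopologicalSpace X] [ChartedSpace E X] [IsManifold 𝓘(ℂ, E) ω X]

variable (E X) in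
/-- The real manifold underlying a complex manifold. -/
theorem isManifold_real (n : ℕ∞ω) : IsManifold 𝓘(ℝ, E) n X :=
  isManifold_of_contDiffOn _ _ _ fun e e' he he' ↦ by
    have h := ((contDiffOn_transition he' he).of_le (le_top : n ≤ ω)).restrict_scalars ℝ
    simpa using h

theorem Cocycle.isManifold_real_Z {ι : Type*} (c : Cocycle E X ι) (n : ℕ∞ω) :
    IsManifold (𝓘(ℝ, E).prod 𝓘(ℝ, E →L[ℂ] ℂ)) n c.Z :=
  isManifold_of_contDiffOn _ _ _ fun e e' he he' ↦ by
    have h := (contDiffGroupoid ω (𝓘(ℂ, E).prod 𝓘(ℂ, E →L[ℂ] ℂ))).compatible he he'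
    rw [contDiffGroupoid, mem_groupoid_of_pregroupoid] at h
    exact (h.1.of_le (le_top : n ≤ ω)).restrict_scalars ℝ

end RealManifolds

/-! ### Existence of a cover, a cocycle and primitives. -/

section Existence

variable {E : Type*} [NormedAddCommGroup E] [NormedSpace ℂ E] [FiniteDimensional ℂ E]
  {X : Type*} [TopologicalSpace X] [ChartedSpace E X] [IsManifold 𝓘(ℂ, E) ω X]

/-- The cover is indexed by the points of `X`, with one local primitive chosen around each; the
cocycle is the coboundary of these primitives, holomorphic because their `∂̄` agree. -/
theorem IsKahlerForm.exists_isPrimitive {κ : RealTwoForm E X} (hκ : IsKahlerForm κ) :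
    ∃ (c : Cocycle E X X) (ρ : X → OneZeroForm E X), c.IsPrimitive κ ρ := by
  choose U ρ hU hx hs hd using hκ.exists_oneZeroForm
  exact ⟨
    { cover := U
      isOpen_cover := hU
      exists_mem_cover := fun x ↦ ⟨x, hx x⟩
      a := fun i j x ↦ ρ i x - ρ j x
      holomorphic := fun i j ↦ OneZeroForm.isHolomorphicOn_sub (hU i) (hU j) (hs i) (hs j)
        (hd i) (hd j)
      cocycle := fun i j k x _ ↦ sub_add_sub_cancel _ _ _ }, ρ, hs, hd, fun _ _ _ _ ↦ rfl⟩

end Existence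

/-! ### Smoothness and analyticity of the section. -/

section Section

open Manifold

variable {E : Type*} [NormedAddCommGroup E] [NormedSpace ℂ E]
  {X : Type*} [TopologicalSpace X] [ChartedSpace E X] [IsManifold 𝓘(ℂ, E) ω X]
  {ι : Type*} {c : Cocycle E X ι} {κ : RealTwoForm E X} {ρ : ι → OneZeroForm E X}

namespace Cocycle

variable (c) in
/-- The expression of the section `c.sectionOf ρ` in the preferred chart at `x`. -/
def localSection (ρ : ι → OneZeroForm E X) (x : X) : E → E →L[ℂ] ℂ :=
  (ρ (c.core.indexAt x).1).inChart (chartAt E x)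

variable (c) in
/-- The domain of `c.localSection ρ x`. -/
def localDomain (x : X) : Set E :=
  (chartAt E x).target ∩ (chartAt E x).symm ⁻¹' (c.cover (c.core.indexAt x).1)

variable (c) in
theorem isOpen_localDomain (x : X) : IsOpen (c.localDomain x) :=
  (chartAt E x).isOpen_inter_preimage_symm (c.isOpen_cover _)

variable (c) in
theorem mem_localDomain (x : X) : chartAt E x x ∈ c.localDomain x :=
  ⟨mem_chart_target E x, by
    rw [mem_preimage, (chartAt E x).left_inv (mem_chart_source E x)]
    exact (c.core.mem_baseSet_at x).1⟩

/-- The index of the preferred trivialization at `x` has `achart E x` as its chart component, so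
fibre coordinate and base coordinate are read in the same chart. -/
theorem IsPrimitive.trivialization_sectionOf (h : c.IsPrimitive κ ρ) {x y : X}
    (hy : y ∈ c.cover (c.core.indexAt x).1) (hy' : y ∈ (chartAt E x).source) :
    trivializationAt (E →L[ℂ] ℂ) c.core.Fiber x (c.sectionOf ρ y) =
      (y, c.localSection ρ x (chartAt E x y)) :=
  c.localTriv_sectionOf h.sub_eq (c.core.indexAt x) ⟨hy, hy'⟩

theorem IsPrimitive.contDiffOn_localSection (h : c.IsPrimitive κ ρ) (x : X) :
    ContDiffOn ℝ ∞ (c.localSection ρ x) (c.localDomain x) :=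
  h.smooth _ _ (chart_mem_atlas E x)

theorem IsPrimitive.contMDiffAt_sectionOf (h : c.IsPrimitive κ ρ) {n : ℕ∞ω} {x : X}
    (hn : ContDiffAt ℝ n (c.localSection ρ x) (chartAt E x x)) :
    ContMDiffAt 𝓘(ℝ, E) (𝓘(ℝ, E).prod 𝓘(ℝ, E →L[ℂ] ℂ)) n (c.sectionOf ρ) x := by
  have := isManifold_real E X n
  rw [contMDiffAt_totalSpace]
  refine ⟨contMDiffAt_id, ?_⟩
  have h1 : ContMDiffAt 𝓘(ℝ, E) 𝓘(ℝ, E →L[ℂ] ℂ) n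
      (fun y ↦ c.localSection ρ x (chartAt E x y)) x :=
    hn.contMDiffAt.comp x (contMDiffAt_extChartAt (I := 𝓘(ℝ, E)) (n := n) (x := x))
  refine h1.congr_of_eventuallyEq ?_
  filter_upwards [(c.isOpen_cover _).mem_nhds (c.core.mem_baseSet_at x).1,
    (chartAt E x).open_source.mem_nhds (mem_chart_source E x)] with y hy hy'
  exact congrArg Prod.snd (h.trivialization_sectionOf hy hy')

theorem IsPrimitive.contDiffAt_localSection (h : c.IsPrimitive κ ρ) (x : X) :
    ContDiffAt ℝ ∞ (c.localSection ρ x) (chartAt E x x) :=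
  (h.contDiffOn_localSection x).contDiffAt ((c.isOpen_localDomain x).mem_nhds (c.mem_localDomain x))

theorem IsPrimitive.contMDiff_sectionOf (h : c.IsPrimitive κ ρ) :
    ContMDiff 𝓘(ℝ, E) (𝓘(ℝ, E).prod 𝓘(ℝ, E →L[ℂ] ℂ)) ∞ (c.sectionOf ρ) :=
  fun x ↦ h.contMDiffAt_sectionOf (h.contDiffAt_localSection x)

theorem IsPrimitive.dbarDeriv_localSection (h : c.IsPrimitive κ ρ) (hκ : IsKahlerForm κ) (x : X)
    {z : E} (hz : z ∈ c.localDomain x) (u : E) : dbarDeriv (c.localSection ρ x) z u =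
      antilinearPart E (κ.inChart (chartAt E x) z) u :=
  (dbar_eq_iff (hκ.inChart_I_smul _ z)).1 (h.dbar_eq _ _ (chart_mem_atlas E x) z hz) u

/-- The primitives are only assumed smooth. Their analyticity comes from the `∂̄`-equation, whose
right-hand side is analytic with `κ`. -/
theorem IsPrimitive.contMDiff_omega_sectionOf [FiniteDimensional ℂ E] (h : c.IsPrimitive κ ρ)
    (hκ : IsKahlerForm κ) (hω : κ.IsOfClass ω) :
    ContMDiff 𝓘(ℝ, E) (𝓘(ℝ, E).prod 𝓘(ℝ, E →L[ℂ] ℂ)) ω (c.sectionOf ρ) := fun x ↦ by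
  refine h.contMDiffAt_sectionOf (AnalyticAt.contDiffAt ?_)
  have hnhds := (c.isOpen_localDomain x).mem_nhds (c.mem_localDomain x)
  have hg : ContDiffAt ℝ ω (fun z ↦ antilinearPart E (κ.inChart (chartAt E x) z))
      (chartAt E x x) :=
    contDiff_antilinearPart.contDiffAt.comp _ ((hω _ (chart_mem_atlas E x)).contDiffAt
      ((chartAt E x).open_target.mem_nhds (mem_chart_target E x)))
  refine analyticAt_of_dbarDeriv_eq (g := fun z ↦ antilinearPart E (κ.inChart (chartAt E x) z))
    ?_ hg.analyticAt ?_
  · filter_upwards [(c.isOpen_localDomain x).eventually_mem (c.mem_localDomain x)] with z hz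
    exact (h.contDiffOn_localSection x).contDiffAt ((c.isOpen_localDomain x).mem_nhds hz)
  · filter_upwards [hnhds] with z hz u
    exact h.dbarDeriv_localSection hκ x hz u

end Cocycle
end Section

/-! ### Shears as admissible changes of chart. -/

section Shear

variable {V W : Type*} [NormedAddCommGroup V] [NormedSpace ℝ V] [NormedAddCommGroup W]
  [NormedSpace ℝ W]

/-- The shear `(z, w) ↦ (z, w - f z)` over an open set `D`. -/
def shear {f : V → W} {D : Set V} (hD : IsOpen D) (hf : ContinuousOn f D) :
    OpenPartialHomeomorph (ModelProd V W) (ModelProd V W) where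
  toFun p := (p.1, p.2 - f p.1)
  invFun p := (p.1, p.2 + f p.1)
  source := D ×ˢ univ
  target := D ×ˢ univ
  map_source' _ hp := ⟨hp.1, mem_univ _⟩
  map_target' _ hp := ⟨hp.1, mem_univ _⟩
  left_inv' _ _ := Prod.ext rfl (sub_add_cancel _ _)
  right_inv' _ _ := Prod.ext rfl (add_sub_cancel_right _ _)
  open_source := hD.prod isOpen_univ
  open_target := hD.prod isOpen_univ
  continuousOn_toFun := continuousOn_fst.prodMk
    (continuousOn_snd.sub (hf.comp continuousOn_fst fun _ hp ↦ hp.1))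
  continuousOn_invFun := continuousOn_fst.prodMk
    (continuousOn_snd.add (hf.comp continuousOn_fst fun _ hp ↦ hp.1))

theorem shear_mem_contDiffGroupoid {f : V → W} {D : Set V} (hD : IsOpen D) {n : ℕ∞ω}
    (hf : ContDiffOn ℝ n f D) :
    shear hD hf.continuousOn ∈ contDiffGroupoid n (𝓘(ℝ, V).prod 𝓘(ℝ, W)) := by
  rw [contDiffGroupoid, mem_groupoid_of_pregroupoid]
  have h : ContDiffOn ℝ n (fun p : V × W ↦ f p.1) (D ×ˢ univ) :=
    hf.comp contDiffOn_fst fun _ hp ↦ hp.1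
  constructor
  · exact (contDiffOn_fst.prodMk (contDiffOn_snd.sub h)).mono fun p hp ↦ hp.1
  · exact (contDiffOn_fst.prodMk (contDiffOn_snd.add h)).mono fun p hp ↦ hp.1

theorem trans_mem_maximalAtlas {H M : Type*} [TopologicalSpace H] [TopologicalSpace M]
    [ChartedSpace H M] {G : StructureGroupoid H} {e : OpenPartialHomeomorph M H}
    {g : OpenPartialHomeomorph H H} (he : e ∈ G.maximalAtlas M) (hg : g ∈ G) :
    e ≫ₕ g ∈ G.maximalAtlas M := by
  rw [mem_maximalAtlas_iff] at he ⊢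
  refine fun e' he' ↦ ⟨?_, ?_⟩
  · rw [OpenPartialHomeomorph.trans_symm_eq_symm_trans_symm, OpenPartialHomeomorph.trans_assoc]
    exact G.trans (G.symm hg) (he e' he').1
  · rw [← OpenPartialHomeomorph.trans_assoc]
    exact G.trans (he e' he').2 hg

end Shear

/-! ### The section as a totally real embedding. -/

section Embedding

open Manifold

variable {E : Type*} [NormedAddCommGroup E] [NormedSpace ℂ E]
  {X : Type*} [TopologicalSpace X] [ChartedSpace E X] [IsManifold 𝓘(ℂ, E) ω X]
  {ι : Type*} {c : Cocycle E X ι} {κ : RealTwoForm E X} {ρ : ι → OneZeroForm E X}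

namespace Cocycle

theorem IsPrimitive.chartAt_sectionOf (h : c.IsPrimitive κ ρ) {x y : X}
    (hy : y ∈ c.cover (c.core.indexAt x).1) (hy' : y ∈ (chartAt E x).source) :
    chartAt (ModelProd E (E →L[ℂ] ℂ)) (c.sectionOf ρ x) (c.sectionOf ρ y) =
      (chartAt E x y, c.localSection ρ x (chartAt E x y)) := by
  rw [FiberBundle.chartedSpace_chartAt]
  change (fun p : X × (E →L[ℂ] ℂ) ↦ (chartAt E x p.1, p.2))
    (trivializationAt (E →L[ℂ] ℂ) c.core.Fiber x (c.sectionOf ρ y)) = _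
  rw [h.trivialization_sectionOf hy hy']

theorem IsPrimitive.isEmbedding_sectionOf (h : c.IsPrimitive κ ρ) :
    Topology.IsEmbedding (c.sectionOf ρ) :=
  Topology.IsEmbedding.of_leftInverse (f := TotalSpace.proj) (fun _ ↦ rfl)
    (FiberBundle.continuous_proj (E →L[ℂ] ℂ) c.core.Fiber) h.contMDiff_sectionOf.continuous

/-- Composing the preferred chart of `Z` with the shear by the local section turns the section into
`z ↦ (z, 0)`, so the fibre serves as the complement. -/
theorem IsPrimitive.isImmersionAtOfComplement_sectionOf (h : c.IsPrimitive κ ρ) (x : X) :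
    IsImmersionAtOfComplement (E →L[ℂ] ℂ) 𝓘(ℝ, E) (𝓘(ℝ, E).prod 𝓘(ℝ, E →L[ℂ] ℂ)) ∞
      (c.sectionOf ρ) x := by
  have := isManifold_real E X ∞
  have := c.isManifold_real_Z ∞
  have hx := (c.core.mem_baseSet_at x).1
  have hx' := mem_chart_source E x
  have hU := c.isOpen_cover (c.core.indexAt x).1
  have hf := h.contDiffOn_localSection x
  have hD := c.isOpen_localDomain x
  refine IsImmersionAtOfComplement.mk_of_continuousAt h.contMDiff_sectionOf.continuous.continuousAt
    (ContinuousLinearEquiv.refl ℝ _) ((chartAt E x).restr (c.cover (c.core.indexAt x).1))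
    (chartAt (ModelProd E (E →L[ℂ] ℂ)) (c.sectionOf ρ x) ≫ₕ shear hD hf.continuousOn)
    ?_ ?_ ?_ ?_ ?_
  · rw [OpenPartialHomeomorph.restr_source, hU.interior_eq]
    exact ⟨hx', hx⟩
  · rw [OpenPartialHomeomorph.trans_source]
    refine ⟨mem_chart_source _ _, ?_⟩
    rw [mem_preimage, h.chartAt_sectionOf hx hx']
    exact ⟨c.mem_localDomain x, mem_univ _⟩
  · exact restr_mem_maximalAtlas _ (IsManifold.chart_mem_maximalAtlas x) hU
  · exact trans_mem_maximalAtlas (IsManifold.chart_mem_maximalAtlas _)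
      (shear_mem_contDiffGroupoid hD hf)
  · intro z hz
    have hz1 : z ∈ (chartAt E x).target ∧
        (chartAt E x).symm z ∈ c.cover (c.core.indexAt x).1 := by
      simpa [OpenPartialHomeomorph.restr, hU.interior_eq] using hz
    have hy := (chartAt E x).map_target hz1.1
    change shear hD hf.continuousOn (chartAt (ModelProd E (E →L[ℂ] ℂ)) (c.sectionOf ρ x)
      (c.sectionOf ρ ((chartAt E x).symm z))) = (z, 0)
    rw [h.chartAt_sectionOf hz1.2 hy, (chartAt E x).right_inv hz1.1]
    exact Prod.ext rfl (sub_self _)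

theorem IsPrimitive.isSmoothEmbedding_sectionOf (h : c.IsPrimitive κ ρ) :
    IsSmoothEmbedding 𝓘(ℝ, E) (𝓘(ℝ, E).prod 𝓘(ℝ, E →L[ℂ] ℂ)) ∞ (c.sectionOf ρ) :=
  ⟨IsImmersionOfComplement.isImmersion h.isImmersionAtOfComplement_sectionOf,
    h.isEmbedding_sectionOf⟩

theorem IsPrimitive.hasMFDerivAt_sectionOf (h : c.IsPrimitive κ ρ) (x : X) :
    HasMFDerivAt 𝓘(ℝ, E) (𝓘(ℝ, E).prod 𝓘(ℝ, E →L[ℂ] ℂ)) (c.sectionOf ρ) x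
      ((ContinuousLinearMap.id ℝ E).prod
        (fderiv ℝ (c.localSection ρ x) (chartAt E x x)) : E →L[ℝ] E × (E →L[ℂ] ℂ)) := by
  refine ⟨h.contMDiff_sectionOf.continuous.continuousAt, ?_⟩
  have h1 : HasFDerivAt (fun z : E ↦ (z, c.localSection ρ x z))
      ((ContinuousLinearMap.id ℝ E).prod (fderiv ℝ (c.localSection ρ x) (chartAt E x x)))
      (chartAt E x x) :=
    (hasFDerivAt_id _).prodMk
      ((h.contDiffAt_localSection x).differentiableAt (by simp)).hasFDerivAt
  have h2 : writtenInExtChartAt 𝓘(ℝ, E) (𝓘(ℝ, E).prod 𝓘(ℝ, E →L[ℂ] ℂ)) x (c.sectionOf ρ)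
      =ᶠ[𝓝 (chartAt E x x)] fun z : E ↦ (z, c.localSection ρ x z) := by
    filter_upwards [(c.isOpen_localDomain x).mem_nhds (c.mem_localDomain x)] with z hz
    change chartAt (ModelProd E (E →L[ℂ] ℂ)) (c.sectionOf ρ x)
      (c.sectionOf ρ ((chartAt E x).symm z)) = _
    rw [h.chartAt_sectionOf hz.2 ((chartAt E x).map_target hz.1), (chartAt E x).right_inv hz.1]
  exact (h1.congr_of_eventuallyEq h2).hasFDerivWithinAt

end Cocycle

theorem chartSymmDeriv_injective {e : OpenPartialHomeomorph X E} (he : e ∈ atlas E X) {z : E}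
    (hz : z ∈ e.target) : Function.Injective (chartSymmDeriv e z) := by
  have : IsManifold 𝓘(ℂ, E) 1 X := IsManifold.of_le (n := ω) le_top
  have hmd : e.MDifferentiable 𝓘(ℂ, E) 𝓘(ℂ, E) := mdifferentiable_of_mem_atlas he
  have h := hmd.comp_symm_deriv hz
  exact Function.LeftInverse.injective (g := mfderiv 𝓘(ℂ, E) 𝓘(ℂ, E) e (e.symm z))
    fun v ↦ congrArg (fun A ↦ A v) h

/-- The only use of positivity: evaluated at `v` itself, the antilinear part is `-i κ(v, J v) / 2`.
-/
theorem IsKahlerForm.eq_zero_of_antilinearPart_eq_zero (hκ : IsKahlerForm κ)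
    {e : OpenPartialHomeomorph X E} (he : e ∈ atlas E X) {z : E} (hz : z ∈ e.target) {v : E}
    (hv : antilinearPart E (κ.inChart e z) v = 0) : v = 0 := by
  by_contra hne
  have h1 := antilinearPart_apply (κ.inChart e z) v v
  have h2 := alternating_swap (κ.inChart e z) v v
  have h3 : κ.inChart e z ![v, v] = 0 := by linarith
  rw [hv, h3] at h1
  have h4 : κ.inChart e z ![v, Complex.I • v] = 0 := by simpa using h1
  have h5 : chartSymmDeriv e z v ≠ 0 := fun h0 ↦
    hne (chartSymmDeriv_injective he hz (h0.trans (map_zero _).symm))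
  have h6 := hκ.pos _ _ h5
  rw [RealTwoForm.inChart_apply, map_smul] at h4
  exact h6.ne' h4

theorem Cocycle.IsPrimitive.isTotallyRealEmbedding_sectionOf (h : c.IsPrimitive κ ρ)
    (hκ : IsKahlerForm κ) : IsTotallyRealEmbedding 𝓘(ℝ, E) (𝓘(ℝ, E).prod 𝓘(ℝ, E →L[ℂ] ℂ))
      (c.sectionOf ρ) := by
  refine ⟨h.isSmoothEmbedding_sectionOf, fun x ↦ ?_⟩
  set D := fderiv ℝ (c.localSection ρ x)
    (chartAt E x x)
  -- The hypotheses say `(u, D u) = i (v, D v)`, a common vector of the graph of `D` and its image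
  -- under `J`. Hence `D` commutes with `i` at `v`, and the antilinear derivative vanishes there.
  have key : ∀ u v : E, Complex.I • v = u → Complex.I • D v = D u → u = 0 := fun u v h1 h2 ↦ by
    have h3 : dbarDeriv (c.localSection ρ x) (chartAt E x x) v = 0 :=
      dbarDeriv_eq_zero_of_I_smul (h2.trans (congrArg D h1.symm))
    rw [h.dbarDeriv_localSection hκ x (c.mem_localDomain x)] at h3
    rw [← h1, hκ.eq_zero_of_antilinearPart_eq_zero (chart_mem_atlas E x) (mem_chart_target E x) h3,
      smul_zero]
  rw [(h.hasMFDerivAt_sectionOf x).mfderiv, eq_bot_iff]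
  rintro _ ⟨⟨u, rfl⟩, _, ⟨v, rfl⟩, huv⟩
  obtain rfl : u = 0 := key u v (congrArg Prod.fst huv) (congrArg Prod.snd huv)
  exact map_zero _

end Embedding

end CanonicalExtension

end

/-- For a Kähler form `κ` on a complex manifold `X`, local `∂̄`-primitives of `κ` exist and give a
Čech cocycle representing the class of `κ`; and for every cocycle `c` representing the class and
every family `ρ` of local primitives of `κ` inducing it, the section of `Z → X` defined by `ρ` is
smooth and a totally real embedding, and it is real analytic if `κ` is. -/
theorem mainTheorem7 {E : Type*} [NormedAddCommGroup E] [NormedSpace ℂ E] [FiniteDimensional ℂ E]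
    {X : Type u} [TopologicalSpace X] [ChartedSpace E X] [IsManifold 𝓘(ℂ, E) ω X]
    (κ : CanonicalExtension.RealTwoForm E X) (hκ : CanonicalExtension.IsKahlerForm κ) :
    (∃ (ι : Type u) (c : CanonicalExtension.Cocycle E X ι)
        (ρ : ι → CanonicalExtension.OneZeroForm E X), c.IsPrimitive κ ρ) ∧
      ∀ (ι : Type v) (c : CanonicalExtension.Cocycle E X ι)
        (ρ : ι → CanonicalExtension.OneZeroForm E X), c.IsPrimitive κ ρ →
        (∀ x, (c.sectionOf ρ x).proj = x) ∧
        ContMDiff 𝓘(ℝ, E) (𝓘(ℝ, E).prod 𝓘(ℝ, E →L[ℂ] ℂ)) ∞ (c.sectionOf ρ) ∧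
        CanonicalExtension.IsTotallyRealEmbedding 𝓘(ℝ, E) (𝓘(ℝ, E).prod 𝓘(ℝ, E →L[ℂ] ℂ))
          (c.sectionOf ρ) ∧
        (κ.IsOfClass ω →
          ContMDiff 𝓘(ℝ, E) (𝓘(ℝ, E).prod 𝓘(ℝ, E →L[ℂ] ℂ)) ω (c.sectionOf ρ)) := by
  refine ⟨⟨X, hκ.exists_isPrimitive⟩, fun ι c ρ h ↦ ?_⟩
  exact ⟨fun _ ↦ rfl, h.contMDiff_sectionOf, h.isTotallyRealEmbedding_sectionOf hκ,
    h.contMDiff_omega_sectionOf hκ⟩
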